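/- Let $q$ be a prime power, let $k\ge 3$ and $s,n$ be integers, and let $\mathrm{PG}(k-1,q)$ be the projective space of a $k$-dimensional vector space over the field with $q$ elements. For $r\ge k-1$, an $(n,r)$-arc in $\mathrm{PG}(k-1,q)$ is a set of $n>r$ points such that every hyperplane contains at most $r$ of them and some hyperplane contains exactly $r$ of them. A hyperplane is a secant of an $(n,r)$-arc if it contains exactly $r$ points of the arc, and a tangent if it contains at least one but fewer than $r$ points of the arc. An $(n,r)$-arc is complete if no further point can be added to it to form an $(n+1,r)$-arc. An $(n,k+s-1)$-arc in $\mathrm{PG}(k-1,q)$ is maximal if $n=(s+1)(q+1)+k-2$. Let $\mathcal K$ be an $(n,k+s-1)$-arc in $\mathrm{PG}(k-1,q)$, where $k\ge 3$, $0<s<q-2$ and $(s+2)\mid q$. If $n=(s+1)(q+1)+k-3$, then there is a unique point $X$ of $\mathrm{PG}(k-1,q)$ that lies on every tangent of $\mathcal K$ and on no secant of $\mathcal K$. Moreover, $\mathcal K$ is not complete, and there is a unique maximal $(n+1,k+s-1)$-arc containing $\mathcal K$. -/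

import Mathlib

open scoped LinearAlgebra.Projectivization

namespace PGArc

/-!
The projective space `PG(k-1, q)` is `ℙ F V`, for a vector space `V` of dimension `k` over the field
`F` with `q` elements. Its flats are given by the linear subspaces of `V`.
-/

variable {F V : Type*} [Field F] [AddCommGroup V] [Module F V]

/-- The point `P` of the projective space lies on the flat given by the linear subspace `H`. -/
def Incident (P : ℙ F V) (H : Submodule F V) : Prop :=
  P.submodule ≤ H

/-- Hyperplanes are the flats of codimension one. -/
def IsHyperplane (H : Submodule F V) : Prop :=
  Module.finrank F H + 1 = Module.finrank F V

/-- The set of points of `K` on the flat `H`. -/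
def pointsOn (K : Set (ℙ F V)) (H : Submodule F V) : Set (ℙ F V) :=
  {P | P ∈ K ∧ Incident P H}

/-- `K` is an `(n, r)`-arc in `PG(k-1, q)`, where `k = dim V`: `r ≥ k - 1`, `K` is a set of `n > r`
points, every hyperplane contains at most `r` points of `K`, and some hyperplane contains
exactly `r`. -/
structure IsArc (K : Set (ℙ F V)) (n r : ℕ) : Prop where
  le_r : Module.finrank F V ≤ r + 1
  lt_n : r < n
  finite : K.Finite
  card_eq : K.ncard = n
  le_of_hyperplane : ∀ H : Submodule F V, IsHyperplane H → (pointsOn K H).ncard ≤ r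
  exists_hyperplane : ∃ H : Submodule F V, IsHyperplane H ∧ (pointsOn K H).ncard = r

/-- `H` is a secant hyperplane of the `(n, r)`-arc `K`: it contains exactly `r` points of `K`. -/
def IsSecant (K : Set (ℙ F V)) (r : ℕ) (H : Submodule F V) : Prop :=
  IsHyperplane H ∧ (pointsOn K H).ncard = r

/-- `H` is a tangent hyperplane of the `(n, r)`-arc `K`: it contains a positive number of points
of `K`, but fewer than `r`. -/
def IsTangent (K : Set (ℙ F V)) (r : ℕ) (H : Submodule F V) : Prop :=
  IsHyperplane H ∧ 0 < (pointsOn K H).ncard ∧ (pointsOn K H).ncard < r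

/-- The `(n, r)`-arc `K` is complete: no further point can be added to `K` to form an
`(n + 1, r)`-arc. -/
def IsComplete (K : Set (ℙ F V)) (n r : ℕ) : Prop :=
  IsArc K n r ∧ ¬ ∃ P : ℙ F V, P ∉ K ∧ IsArc (insert P K) (n + 1) r

/-- `K` is a maximal `(n, k + s - 1)`-arc in `PG(k-1, q)`, where `k = dim V` and `q = |F|`: it meets
the bound `n ≤ (s + 1) (q + 1) + k - 2` with equality. -/
def IsMaximalArc (K : Set (ℙ F V)) (n s : ℕ) : Prop :=
  IsArc K n (Module.finrank F V + s - 1) ∧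
    n = (s + 1) * (Nat.card F + 1) + Module.finrank F V - 2

end PGArc

/-! Put ρ = s + 1. In a plane, call a line with exactly ρ arc points a ρ-line. The lines through an
arc point have total deficiency (q + 1)(ρ + 1) - (q + ρ(q + 1)) = 1 from the bound ρ + 1, so exactly
one of them is a ρ-line, and there are q + 1 ρ-lines in all. Since ρ + 1 divides q, a congruence
modulo ρ + 1 puts every point on at least one ρ-line (`exists_killer_of_dvd`). Hence each point of a
line that is not a ρ-line is on exactly one, and the meeting point of two ρ-lines has only ρ-lines
through it. This nucleus (`exists_nucleus`) is the required X, and adding it makes the arc maximal.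

For k > 3 no such arc exists (`no_almost_maximal_family`). Projection from arc points reduces to k =
4. There the nuclei of the projections from single arc points lift to lines that meet pairwise and
are not coplanar, hence are concurrent. Their common point extends the arc to a maximal one
(`exists_extension`). A maximal arc is impossible by a second moment count of the secant lines
(here: lines on two arc points) through points off the arc (`no_maximal_family`).

The counts use families of vectors, which survive projection without any distinctness check, and
nonzero linear forms, so that each hyperplane is counted q - 1 times. -/

namespace PGArc

/-! ### Double counting with vectors and linear forms -/

section Counting

open Module Finset
open scoped Classical

variable {F V ι : Type*} [Field F] [AddCommGroup V] [Module F V]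

/-- The indices at which the linear form `f` vanishes on the family `v`. -/
noncomputable def zeros [Fintype ι] (v : ι → V) (f : Dual F V) : Finset ι :=
  univ.filter fun i => f (v i) = 0

lemma mem_zeros [Fintype ι] {v : ι → V} {f : Dual F V} {i : ι} : i ∈ zeros v f ↔ f (v i) = 0 := by
  simp [zeros]

lemma zeros_smul [Fintype ι] (v : ι → V) (f : Dual F V) {c : F} (hc : c ≠ 0) :
    zeros v (c • f) = zeros v f := by
  ext i; simp [mem_zeros, hc]

/-- The nonzero linear forms that vanish on `W`. -/
noncomputable def killers [Fintype (Dual F V)] (W : Submodule F V) : Finset (Dual F V) :=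
  univ.filter fun f => f ≠ 0 ∧ W ≤ LinearMap.ker f

lemma mem_killers [Fintype (Dual F V)] {W : Submodule F V} {f : Dual F V} :
    f ∈ killers W ↔ f ≠ 0 ∧ W ≤ LinearMap.ker f := by
  simp [killers]

lemma mem_killers_span [Fintype (Dual F V)] {x : V} {f : Dual F V} :
    f ∈ killers (Submodule.span F {x}) ↔ f ≠ 0 ∧ f x = 0 := by
  simp [mem_killers, Submodule.span_singleton_le_iff_mem]

lemma finrank_sup_span_singleton [FiniteDimensional F V] {W : Submodule F V} {x : V} (hx : x ∉ W) :
    finrank F ↥(W ⊔ Submodule.span F {x}) = finrank F W + 1 := by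
  have hx0 : x ≠ 0 := fun h => hx (h ▸ W.zero_mem)
  have h1 := Submodule.finrank_sup_add_finrank_inf_eq W (Submodule.span F {x})
  have h2 : W ⊓ Submodule.span F {x} = ⊥ := by
    rw [← disjoint_iff, Submodule.disjoint_span_singleton' hx0]
    exact hx
  rw [h2, finrank_bot, finrank_span_singleton hx0] at h1
  simpa using h1

lemma exists_finrank_eq_of_le [FiniteDimensional F V] (W : Submodule F V) {d : ℕ} (h1 : finrank F W ≤ d)
    (h2 : d ≤ finrank F V) : ∃ W' : Submodule F V, W ≤ W' ∧ finrank F W' = d := by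
  induction d, h1 using Nat.le_induction with
  | base => exact ⟨W, le_rfl, rfl⟩
  | succ n hn ih =>
    obtain ⟨W', hW, hn'⟩ := ih (by omega)
    have : W' ≠ ⊤ := by
      rintro rfl
      rw [finrank_top] at hn'
      omega
    obtain ⟨x, -, hx⟩ := SetLike.exists_of_lt this.lt_top
    exact ⟨_, hW.trans le_sup_left, by rw [finrank_sup_span_singleton hx, hn']⟩

variable [Fintype F]

lemma card_nonzero_mem [Fintype V] (W : Submodule F V) :
    #(univ.filter fun x : V => x ≠ 0 ∧ x ∈ W) + 1 = Fintype.card F ^ finrank F W := by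
  have h1 : (univ.filter fun x : V => x ≠ 0 ∧ x ∈ W) = (univ.filter fun x : V => x ∈ W).erase 0 := by
    ext x; simp
  have h0 : (0 : V) ∈ univ.filter fun x : V => x ∈ W := by simp
  rw [h1, card_erase_add_one h0, ← card_eq_pow_finrank (K := F) (V := W), Fintype.card_subtype]

lemma card_nonzero_scalars : #(univ.filter fun c : F => c ≠ 0) + 1 = Fintype.card F := by
  rw [filter_ne', card_erase_add_one (mem_univ _), card_univ]

/-- Converts "at least one projective object" into a count: a single scalar class already has q - 1
elements. -/
lemma card_sub_one_le_of_smul_mem {T : Finset V} (hT : ∀ x ∈ T, ∀ c : F, c ≠ 0 → c • x ∈ T)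
    {x : V} (hx : x ≠ 0) (hxT : x ∈ T) : Fintype.card F ≤ #T + 1 := by
  rw [← card_nonzero_scalars]
  refine Nat.succ_le_succ (card_le_card_of_injOn (fun c => c • x) ?_ ?_)
  · intro c hc
    exact hT x hxT c (by simpa using hc)
  · intro c _ d _ h
    exact smul_left_injective F hx h

lemma two_mul_le_of_smul_mem {T : Finset V} (hT : ∀ x ∈ T, ∀ c : F, c ≠ 0 → c • x ∈ T)
    {x y : V} (hx : x ≠ 0) (hxT : x ∈ T) (hyT : y ∈ T) (hxy : y ∉ Submodule.span F {x}) :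
    2 * Fintype.card F ≤ #T + 2 := by
  have h1 := card_sub_one_le_of_smul_mem (F := F) (T := T.filter fun z => z ∈ Submodule.span F {x})
    (fun z hz c hc => by
      rw [mem_filter] at hz ⊢
      exact ⟨hT z hz.1 c hc, Submodule.smul_mem _ _ hz.2⟩) hx
    (by simp [hxT, Submodule.mem_span_singleton_self])
  have h2 := card_sub_one_le_of_smul_mem (F := F) (T := T.filter fun z => z ∉ Submodule.span F {x})
    (fun z hz c hc => by
      rw [mem_filter] at hz ⊢
      exact ⟨hT z hz.1 c hc, fun h => hz.2 ((Submodule.smul_mem_iff _ hc).1 h)⟩)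
    (x := y) (fun h => hxy (h ▸ Submodule.zero_mem _)) (by simp [hxy, hyT])
  have h3 := card_filter_add_card_filter_not (s := T) (fun z => z ∈ Submodule.span F {x})
  omega

variable [Fintype (Dual F V)] [FiniteDimensional F V]

lemma card_killers {W : Submodule F V} {d : ℕ} (h : finrank F W + d = finrank F V) :
    #(killers W) + 1 = Fintype.card F ^ d := by
  have h1 := Subspace.finrank_add_finrank_dualAnnihilator_eq W
  have h2 : finrank F W.dualAnnihilator = d := by omega
  rw [← h2, ← card_nonzero_mem W.dualAnnihilator]
  congr 2
  ext f
  simp only [mem_killers, mem_filter, mem_univ, true_and, Submodule.mem_dualAnnihilator]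
  rfl

variable [Fintype ι]

/-- Double counting of the pairs of a form vanishing on `W` and a vector of the family
killed by it. -/
lemma sum_card_zeros (v : ι → V) {W : Submodule F V} (h : finrank F W + 2 = finrank F V) :
    ∑ f ∈ killers W, #(zeros v f) =
      (Fintype.card F - 1) * (Fintype.card F * #(univ.filter fun i => v i ∈ W) + Fintype.card ι) := by
  obtain ⟨p, hp⟩ : ∃ p, Fintype.card F = p + 1 := ⟨_, (Nat.succ_pred_eq_of_pos Fintype.card_pos).symm⟩
  have h1 := sum_card_bipartiteAbove_eq_sum_card_bipartiteBelow (s := killers W)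
    (t := (univ : Finset ι)) (fun f i => f (v i) = 0)
  -- With p = q - 1, a member in `W` is killed by all q² - 1 = p + p(p + 1) forms; a member outside
  -- only by the p forms that also kill its span with `W`.
  have h2 : ∀ i ∈ (univ : Finset ι), #((killers W).bipartiteBelow (fun f i => f (v i) = 0) i) =
      p + if v i ∈ W then p * (p + 1) else 0 := by
    intro i _
    split_ifs with hi
    · have : (killers W).bipartiteBelow (fun f i => f (v i) = 0) i = killers W := by
        rw [bipartiteBelow, filter_true_of_mem]
        intro f hf
        exact (mem_killers.1 hf).2 hi
      have h3 := card_killers h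
      rw [this]
      rw [hp] at h3
      nlinarith
    · have : (killers W).bipartiteBelow (fun f i => f (v i) = 0) i =
          killers (W ⊔ Submodule.span F {v i}) := by
        ext f
        simp [mem_killers, Submodule.span_singleton_le_iff_mem, and_assoc]
      have h3 := card_killers (W := W ⊔ Submodule.span F {v i}) (d := 1)
        (by rw [finrank_sup_span_singleton hi]; omega)
      rw [this]
      rw [hp, pow_one] at h3
      omega
  rw [sum_congr rfl h2, sum_add_distrib, ← sum_filter, sum_const, sum_const, card_univ] at h1
  refine h1.trans ?_
  rw [hp]
  simp only [smul_eq_mul, Nat.add_sub_cancel]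
  ring

/-- If every hyperplane contains at most `R` vectors of a family, then a subspace of codimension
two contains few of them. -/
lemma card_mem_codim_two (v : ι → V) {R : ℕ} (hR : ∀ f : Dual F V, f ≠ 0 → #(zeros v f) ≤ R)
    {W : Submodule F V} (h : finrank F W + 2 = finrank F V) :
    Fintype.card F * #(univ.filter fun i => v i ∈ W) + Fintype.card ι ≤ (Fintype.card F + 1) * R := by
  have h1 := sum_card_zeros v h
  have h2 : ∑ f ∈ killers W, #(zeros v f) ≤ #(killers W) * R :=
    sum_le_card_nsmul _ _ _ fun f hf => hR f (mem_killers.1 hf).1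
  have h3 := card_killers h
  have h4 : 1 < Fintype.card F := Fintype.one_lt_card
  obtain ⟨p, hp⟩ : ∃ p, Fintype.card F = p + 1 := ⟨_, (Nat.succ_pred_eq_of_pos Fintype.card_pos).symm⟩
  have hp0 : 0 < p := by omega
  rw [h1] at h2
  rw [hp] at h2 h3 ⊢
  have h5 : #(killers W) = p * (p + 2) := by nlinarith
  rw [h5] at h2
  refine Nat.le_of_mul_le_mul_left ?_ hp0
  simp only [Nat.add_sub_cancel] at h2
  calc _ ≤ _ := h2
    _ = _ := by ring

end Counting

/-! ### The planar case: existence of a nucleus -/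

section Plane

open Module Finset
open scoped Classical

variable {F V ι : Type*} [Field F] [AddCommGroup V] [Module F V]

/-- If the two kernels did not span `V`, both would equal their sum, and forms with equal kernels
are proportional. -/
lemma finrank_ker_inf_ker [FiniteDimensional F V] {f g : Dual F V} (hf : f ≠ 0) (hg : g ∉ Submodule.span F {f}) :
    finrank F ↥(LinearMap.ker f ⊓ LinearMap.ker g) + 2 = finrank F V := by
  have hg0 : g ≠ 0 := fun h => hg (h ▸ Submodule.zero_mem _)
  have h1 := Dual.finrank_ker_add_one_of_ne_zero hf
  have h2 := Dual.finrank_ker_add_one_of_ne_zero hg0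
  have h3 := Submodule.finrank_sup_add_finrank_inf_eq (LinearMap.ker f) (LinearMap.ker g)
  have h4 : finrank F ↥(LinearMap.ker f ⊔ LinearMap.ker g) = finrank F V := by
    refine le_antisymm (Submodule.finrank_le _) ?_
    by_contra! hlt
    have h5 : LinearMap.ker f = LinearMap.ker f ⊔ LinearMap.ker g :=
      Submodule.eq_of_le_of_finrank_le le_sup_left (by omega)
    have h6 : LinearMap.ker g = LinearMap.ker f ⊔ LinearMap.ker g :=
      Submodule.eq_of_le_of_finrank_le le_sup_right (by omega)
    obtain ⟨x, hx⟩ : ∃ x, f x ≠ 0 := by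
      by_contra! h
      exact hf (LinearMap.ext h)
    refine hg (Submodule.mem_span_singleton.2 ⟨g x / f x, ?_⟩)
    have hgx : g x ≠ 0 := fun h => hx (by
      have : x ∈ LinearMap.ker f := by rw [h5, ← h6]; exact h
      exact this)
    refine Dual.eq_of_ker_eq_of_apply_eq x ?_ (by simp [hx]) (by simp [hx, hgx])
    rw [LinearMap.ker_smul _ _ (div_ne_zero hgx hx), h5, ← h6]
  omega

variable [Fintype ι] variable [Fintype (Dual F V)]

variable (F) in
/-- The linear forms whose kernel contains exactly `ρ` vectors of the family `v`. -/
noncomputable def formsWith (v : ι → V) (ρ : ℕ) : Finset (Dual F V) :=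
  univ.filter fun f => f ≠ 0 ∧ #(zeros v f) = ρ

lemma mem_formsWith {v : ι → V} {ρ : ℕ} {f : Dual F V} :
    f ∈ formsWith F v ρ ↔ f ≠ 0 ∧ #(zeros v f) = ρ := by
  simp [formsWith]

lemma smul_mem_formsWith {v : ι → V} {ρ : ℕ} {f : Dual F V} (hf : f ∈ formsWith F v ρ) {c : F}
    (hc : c ≠ 0) : c • f ∈ formsWith F v ρ := by
  rw [mem_formsWith] at *
  exact ⟨smul_ne_zero hc hf.1, by rw [zeros_smul v f hc, hf.2]⟩

variable (F) in
/-- The forms of `formsWith F v ρ` that vanish at `u`. -/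
noncomputable def formsWithAt (v : ι → V) (ρ : ℕ) (u : V) : Finset (Dual F V) :=
  (formsWith F v ρ).filter fun f => f u = 0

lemma mem_formsWithAt {v : ι → V} {ρ : ℕ} {u : V} {f : Dual F V} :
    f ∈ formsWithAt F v ρ u ↔ f ∈ formsWith F v ρ ∧ f u = 0 := by
  simp [formsWithAt]

lemma smul_mem_formsWithAt {v : ι → V} {ρ : ℕ} {u : V} {f : Dual F V}
    (hf : f ∈ formsWithAt F v ρ u) (c : F) (hc : c ≠ 0) : c • f ∈ formsWithAt F v ρ u := by
  rw [mem_formsWithAt] at *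
  exact ⟨smul_mem_formsWith hf.1 hc, by simp [hf.2]⟩

variable [Fintype F] [FiniteDimensional F V]

/-- Let w be the number of members on `u`. The forms killing `u` have (q - 1)(qw + ρ(q + 1))
incidences in all, which is ≡ -ρ ≡ 1 modulo ρ + 1 because q ≡ 0. So the individual counts cannot all
be multiples of ρ + 1. -/
lemma exists_killer_of_dvd {v : ι → V} {ρ : ℕ} (hρ : 0 < ρ) (hV : finrank F V = 3)
    (hι : Fintype.card ι = ρ * (Fintype.card F + 1)) (hdvd : ρ + 1 ∣ Fintype.card F)
    {u : V} (hu : u ≠ 0) :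
    ∃ f : Dual F V, f ≠ 0 ∧ f u = 0 ∧ #(zeros v f) ≠ 0 ∧ #(zeros v f) ≠ ρ + 1 := by
  by_contra! hcon
  have h1 := sum_card_zeros v (W := Submodule.span F {u}) (by rw [finrank_span_singleton hu, hV])
  have h2 : ρ + 1 ∣ ∑ f ∈ killers (Submodule.span F {u}), #(zeros v f) := by
    refine dvd_sum fun f hf => ?_
    rw [mem_killers_span] at hf
    by_cases h0 : #(zeros v f) = 0
    · simp [h0]
    · rw [hcon f hf.1 hf.2 h0]
  rw [h1, hι] at h2
  obtain ⟨t, ht⟩ := hdvd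
  have hq : 1 < Fintype.card F := Fintype.one_lt_card
  set w := #(univ.filter fun i => v i ∈ Submodule.span F {u})
  set q := Fintype.card F
  zify [hq.le] at h2 ht
  have h3 : (ρ + 1 : ℤ) ∣ 1 := by
    have h4 : ((q : ℤ) - 1) * (q * w + ρ * (q + 1)) =
        (ρ + 1) * (t * (q * w + ρ * (q + 1)) - t * w - ρ * t - 1) + 1 := by
      linear_combination (q * w + ρ * (q + 1) - w - ρ : ℤ) * ht
    rw [h4] at h2
    exact (dvd_add_right (Dvd.intro _ rfl)).1 h2
  have h5 := Int.le_of_dvd one_pos h3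
  omega

/-- The codimension-two bound becomes qw ≤ q + 1, so w ≤ 1: the family has no repeated projective
points. -/
lemma card_mem_span_singleton_le_one {v : ι → V} {ρ : ℕ} (hV : finrank F V = 3)
    (hι : Fintype.card ι = ρ * (Fintype.card F + 1))
    (hR : ∀ f : Dual F V, f ≠ 0 → #(zeros v f) ≤ ρ + 1) {u : V} (hu : u ≠ 0) :
    #(univ.filter fun i => v i ∈ Submodule.span F {u}) ≤ 1 := by
  have h1 := card_mem_codim_two v hR (W := Submodule.span F {u})
    (by rw [finrank_span_singleton hu, hV])
  have hq : 1 < Fintype.card F := Fintype.one_lt_card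
  rw [hι] at h1
  by_contra! h
  nlinarith

lemma family_ne_zero {v : ι → V} {ρ : ℕ} (hρ : 0 < ρ) (hV : finrank F V = 3)
    (hι : Fintype.card ι = ρ * (Fintype.card F + 1))
    (hR : ∀ f : Dual F V, f ≠ 0 → #(zeros v f) ≤ ρ + 1) (i : ι) : v i ≠ 0 := by
  intro hi
  have hq : 1 < Fintype.card F := Fintype.one_lt_card
  have : Nontrivial ι := by
    rw [← Fintype.one_lt_card_iff_nontrivial, hι]
    nlinarith
  have : Nontrivial V := Module.nontrivial_of_finrank_pos (R := F) (by omega)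
  obtain ⟨j, hj⟩ := exists_ne i
  obtain ⟨u, hu, hju⟩ : ∃ u : V, u ≠ 0 ∧ v j ∈ Submodule.span F {u} := by
    by_cases h : v j = 0
    · obtain ⟨u, hu⟩ := exists_ne (0 : V)
      exact ⟨u, hu, h ▸ Submodule.zero_mem _⟩
    · exact ⟨v j, h, Submodule.mem_span_singleton_self _⟩
  have h1 := card_le_one.1 (card_mem_span_singleton_le_one hV hι hR hu) i
    (by simp [hi]) j (by simpa using hju)
  exact hj h1.symm

/-- The total deficiency through a member is 1 per scalar class, so just one line is deficient, by
exactly one point. -/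
lemma card_zeros_of_mem {v : ι → V} {ρ : ℕ} (hρ : 0 < ρ) (hV : finrank F V = 3)
    (hι : Fintype.card ι = ρ * (Fintype.card F + 1)) (hdvd : ρ + 1 ∣ Fintype.card F)
    (hR : ∀ f : Dual F V, f ≠ 0 → #(zeros v f) ≤ ρ + 1) (i : ι) :
    (∀ f : Dual F V, f ≠ 0 → f (v i) = 0 → #(zeros v f) = ρ ∨ #(zeros v f) = ρ + 1) ∧
      #(formsWithAt F v ρ (v i)) + 1 = Fintype.card F := by
  have hi := family_ne_zero hρ hV hι hR i
  set A := killers (Submodule.span F {v i}) with hA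
  set S := A.filter fun f => #(zeros v f) ≠ ρ + 1 with hS
  have hdim : finrank F (Submodule.span F {v i}) + 2 = finrank F V := by
    rw [finrank_span_singleton hi, hV]
  have hq : 1 < Fintype.card F := Fintype.one_lt_card
  obtain ⟨p, hp⟩ : ∃ p, Fintype.card F = p + 1 := ⟨_, (Nat.succ_pred_eq_of_pos Fintype.card_pos).symm⟩
  have hw : #(univ.filter fun j => v j ∈ Submodule.span F {v i}) = 1 :=
    le_antisymm (card_mem_span_singleton_le_one hV hι hR hi)
      (card_pos.2 ⟨i, by simp [Submodule.mem_span_singleton_self]⟩)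
  have h1 := sum_card_zeros v hdim
  have h2 := card_killers hdim
  have hSq : Fintype.card F ≤ #S + 1 := by
    obtain ⟨f, hf0, hfu, -, hf⟩ := exists_killer_of_dvd (v := v) hρ hV hι hdvd hi
    refine card_sub_one_le_of_smul_mem (F := F) ?_ hf0
      (by rw [hS, mem_filter]; exact ⟨mem_killers_span.2 ⟨hf0, hfu⟩, hf⟩)
    intro g hg c hc
    rw [hS, mem_filter, hA, mem_killers_span] at hg ⊢
    exact ⟨⟨smul_ne_zero hc hg.1.1, by simp [hg.1.2]⟩, by rw [zeros_smul v g hc]; exact hg.2⟩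
  -- Every form in `S` has deficiency at least one. Total deficiency and size of `S` both turn out
  -- to be q - 1, so equality holds term by term.
  have h3 : ∀ f ∈ A, #(zeros v f) + (if #(zeros v f) ≠ ρ + 1 then 1 else 0) ≤ ρ + 1 := by
    intro f hf
    have := hR f (mem_killers.1 hf).1
    split_ifs <;> omega
  have h4 := sum_le_sum h3
  have h4' : ∑ f ∈ A, (#(zeros v f) + (if #(zeros v f) ≠ ρ + 1 then 1 else 0)) =
      ∑ f ∈ A, #(zeros v f) + #S := by
    rw [sum_add_distrib, hS, card_filter]
  rw [h4', h1, hw, hι, sum_const, smul_eq_mul] at h4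
  rw [hw, hι] at h1
  have h5 : #A = p * (p + 2) := by
    rw [hp] at h2
    nlinarith
  have h6 : #S = p := by
    rw [h5, hp, Nat.add_sub_cancel] at h4
    apply le_antisymm
    · nlinarith
    · omega
  have h7 := (sum_eq_sum_iff_of_le h3).1 (by
    rw [h4', h1, sum_const, h5, h6, hp, Nat.add_sub_cancel, smul_eq_mul]
    ring)
  have h8 : ∀ f : Dual F V, f ≠ 0 → f (v i) = 0 → #(zeros v f) = ρ ∨ #(zeros v f) = ρ + 1 := by
    intro f hf hfi
    have := h7 f (mem_killers_span.2 ⟨hf, hfi⟩)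
    split_ifs at this with h
    · left; omega
    · right; omega
  refine ⟨h8, ?_⟩
  have h9 : formsWithAt F v ρ (v i) = S := by
    ext f
    simp only [mem_formsWithAt, mem_formsWith, hS, hA, mem_filter, mem_killers_span]
    constructor
    · rintro ⟨⟨h, h'⟩, h''⟩
      exact ⟨⟨h, h''⟩, by omega⟩
    · rintro ⟨⟨h, h'⟩, h''⟩
      exact ⟨⟨h, (h8 f h h').resolve_right h''⟩, h'⟩
  rw [h9, h6, hp]

/-- Each of the ρ(q + 1) members is on one ρ-line and each ρ-line carries ρ members: q + 1 lines,
hence (q + 1)(q - 1) forms. -/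
lemma card_formsWith {v : ι → V} {ρ : ℕ} (hρ : 0 < ρ) (hV : finrank F V = 3)
    (hι : Fintype.card ι = ρ * (Fintype.card F + 1)) (hdvd : ρ + 1 ∣ Fintype.card F)
    (hR : ∀ f : Dual F V, f ≠ 0 → #(zeros v f) ≤ ρ + 1) :
    #(formsWith F v ρ) + 1 = Fintype.card F ^ 2 := by
  have h1 := sum_card_bipartiteAbove_eq_sum_card_bipartiteBelow
    (s := formsWith F v ρ) (t := (univ : Finset ι)) (fun f i => f (v i) = 0)
  obtain ⟨p, hp⟩ : ∃ p, Fintype.card F = p + 1 := ⟨_, (Nat.succ_pred_eq_of_pos Fintype.card_pos).symm⟩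
  have h2 : ∀ i ∈ (univ : Finset ι),
      #((formsWith F v ρ).bipartiteBelow (fun f i => f (v i) = 0) i) = p := by
    intro i _
    have := (card_zeros_of_mem hρ hV hι hdvd hR i).2
    rw [hp] at this
    exact Nat.succ_injective this
  have h3 : ∀ f ∈ formsWith F v ρ,
      #((univ : Finset ι).bipartiteAbove (fun (f : Dual F V) i => f (v i) = 0) f) = ρ :=
    fun f hf => (mem_formsWith.1 hf).2
  rw [sum_congr rfl h2, sum_congr rfl h3, sum_const, sum_const, card_univ, hι, smul_eq_mul,
    smul_eq_mul, hp] at h1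
  have h4 : #(formsWith F v ρ) = (p + 2) * p := by
    refine Nat.eq_of_mul_eq_mul_right hρ (h1.trans ?_)
    ring
  rw [h4, hp]
  ring

/-- The line given by `exists_killer_of_dvd` contains a member, and lines through a member have ρ or
ρ + 1 points. -/
lemma le_card_formsWithAt {v : ι → V} {ρ : ℕ} (hρ : 0 < ρ) (hV : finrank F V = 3)
    (hι : Fintype.card ι = ρ * (Fintype.card F + 1)) (hdvd : ρ + 1 ∣ Fintype.card F)
    (hR : ∀ f : Dual F V, f ≠ 0 → #(zeros v f) ≤ ρ + 1) {u : V} (hu : u ≠ 0) :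
    Fintype.card F ≤ #(formsWithAt F v ρ u) + 1 := by
  obtain ⟨f, hf, hfu, h0, h1⟩ := exists_killer_of_dvd (v := v) hρ hV hι hdvd hu
  obtain ⟨i, hi⟩ := card_pos.1 (Nat.pos_of_ne_zero h0)
  have h2 := ((card_zeros_of_mem hρ hV hι hdvd hR i).1 f hf (mem_zeros.1 hi)).resolve_right h1
  exact card_sub_one_le_of_smul_mem (F := F) (fun g hg => smul_mem_formsWithAt hg) hf
    (mem_formsWithAt.2 ⟨mem_formsWith.2 ⟨hf, h2⟩, hfu⟩)

/-- The q + 1 ρ-lines each cut the line of `g` in one point, while each of its q + 1 points is on at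
least one of them; so the lower bound is attained everywhere. -/
lemma card_formsWithAt_of_not_mem [Fintype V] {v : ι → V} {ρ : ℕ} (hρ : 0 < ρ)
    (hV : finrank F V = 3)
    (hι : Fintype.card ι = ρ * (Fintype.card F + 1)) (hdvd : ρ + 1 ∣ Fintype.card F)
    (hR : ∀ f : Dual F V, f ≠ 0 → #(zeros v f) ≤ ρ + 1) {g : Dual F V} (hg : g ≠ 0)
    (hgT : g ∉ formsWith F v ρ) {u : V} (hu : u ≠ 0) (hgu : g u = 0) :
    #(formsWithAt F v ρ u) + 1 = Fintype.card F := by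
  obtain ⟨p, hp⟩ : ∃ p, Fintype.card F = p + 1 := ⟨_, (Nat.succ_pred_eq_of_pos Fintype.card_pos).symm⟩
  set U := univ.filter fun x : V => x ≠ 0 ∧ x ∈ LinearMap.ker g with hU
  have hUc := card_nonzero_mem (LinearMap.ker g)
  have hker := Dual.finrank_ker_add_one_of_ne_zero hg
  have hT := card_formsWith hρ hV hι hdvd hR
  rw [show finrank F (LinearMap.ker g) = 2 by omega, ← hT, ← hU] at hUc
  have h1 := sum_card_bipartiteAbove_eq_sum_card_bipartiteBelow
    (s := formsWith F v ρ) (t := U) (fun f x => f x = 0)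
  have h2 : ∀ f ∈ formsWith F v ρ,
      #(U.bipartiteAbove (fun (f : Dual F V) x => f x = 0) f) = p := by
    intro f hf
    have hfg : f ∉ Submodule.span F {g} := by
      intro h
      obtain ⟨c, rfl⟩ := Submodule.mem_span_singleton.1 h
      have hc : c ≠ 0 := fun h => (mem_formsWith.1 hf).1 (by simp [h])
      refine hgT ?_
      have := smul_mem_formsWith hf (inv_ne_zero hc)
      rwa [smul_smul, inv_mul_cancel₀ hc, one_smul] at this
    have h3 := finrank_ker_inf_ker hg hfg
    have h4 := card_nonzero_mem (LinearMap.ker g ⊓ LinearMap.ker f)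
    rw [show finrank F ↥(LinearMap.ker g ⊓ LinearMap.ker f) = 1 by omega, pow_one, hp] at h4
    rw [← Nat.succ_injective h4]
    congr 1
    ext x
    simp [hU, and_assoc, bipartiteAbove]
  -- Both `U` and the set of ρ-forms have q² - 1 elements, so the total is what one ρ-line per point
  -- would give.
  rw [sum_congr rfl h2, sum_const, ← Nat.succ_injective hUc, ← sum_const] at h1
  have h5 : ∀ x ∈ U, p ≤ #((formsWith F v ρ).bipartiteBelow
      (fun f x => f x = 0) x) := by
    intro x hx
    have := le_card_formsWithAt hρ hV hι hdvd hR (u := x) (by simp [hU] at hx; exact hx.1)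
    rw [hp] at this
    exact Nat.le_of_succ_le_succ this
  have h6 := (sum_eq_sum_iff_of_le h5).1 h1 u (by simp [hU, hu, hgu])
  rw [hp, h6]
  rfl

/-- The tangents of a planar arc that is one point short of being maximal are concurrent, if the
degree of the arc divides the order of the plane. -/
theorem exists_nucleus [Fintype V] {v : ι → V} {ρ : ℕ} (hρ : 0 < ρ) (hV : finrank F V = 3)
    (hι : Fintype.card ι = ρ * (Fintype.card F + 1)) (hdvd : ρ + 1 ∣ Fintype.card F)
    (hR : ∀ f : Dual F V, f ≠ 0 → #(zeros v f) ≤ ρ + 1) :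
    ∃ x : V, x ≠ 0 ∧ (∀ f : Dual F V, f ≠ 0 → f x = 0 → #(zeros v f) = ρ) ∧
      (∀ f : Dual F V, f x ≠ 0 → #(zeros v f) = ρ + 1 ∨ #(zeros v f) = 0) ∧
      ∀ i, x ∉ Submodule.span F {v i} := by
  have hq : 1 < Fintype.card F := Fintype.one_lt_card
  have hT := card_formsWith hρ hV hι hdvd hR
  obtain ⟨f₁, hf₁⟩ : (formsWith F v ρ).Nonempty := by
    rw [← card_pos]
    nlinarith
  have hf₁0 := (mem_formsWith.1 hf₁).1
  obtain ⟨f₂, hf₂, hf₁₂⟩ : ∃ f₂ ∈ formsWith F v ρ,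
      f₂ ∉ Submodule.span F {f₁} := by
    by_contra! hcon
    have h1 := card_nonzero_mem (Submodule.span F {f₁})
    rw [finrank_span_singleton hf₁0, pow_one] at h1
    have h2 : #(formsWith F v ρ) + 1 ≤ Fintype.card F := by
      rw [← h1]
      exact Nat.succ_le_succ (card_le_card fun f hf => by
        simpa using ⟨(mem_formsWith.1 hf).1, hcon f hf⟩)
    have h3 : Fintype.card F < Fintype.card F ^ 2 := by nlinarith
    omega
  have h1 := finrank_ker_inf_ker hf₁0 hf₁₂
  obtain ⟨x, hxm, hx⟩ := Submodule.exists_mem_ne_zero_of_ne_bot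
    (p := LinearMap.ker f₁ ⊓ LinearMap.ker f₂) (by
      intro h
      rw [h, finrank_bot] at h1
      omega)
  -- Two distinct ρ-lines through `x` exceed the number allowed on a line that is not a ρ-line, so
  -- every line through `x` is one.
  have h2 := two_mul_le_of_smul_mem (F := F) (T := formsWithAt F v ρ x)
    (fun g hg => smul_mem_formsWithAt hg) hf₁0 (mem_formsWithAt.2 ⟨hf₁, hxm.1⟩)
    (mem_formsWithAt.2 ⟨hf₂, hxm.2⟩) hf₁₂
  have h3 : ∀ f : Dual F V, f ≠ 0 → f x = 0 → f ∈ formsWith F v ρ := by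
    intro f hf hfx
    by_contra h
    have := card_formsWithAt_of_not_mem hρ hV hι hdvd hR hf h hx hfx
    omega
  -- The pencil at `x` has q² - 1 forms, as many as there are ρ-forms, so it exhausts them.
  have h4 : killers (Submodule.span F {x}) = formsWith F v ρ := by
    refine eq_of_subset_of_card_le (fun f hf => ?_) ?_
    · rw [mem_killers_span] at hf
      exact h3 f hf.1 hf.2
    · have := card_killers (W := Submodule.span F {x}) (d := 2)
        (by rw [finrank_span_singleton hx, hV])
      omega
  refine ⟨x, hx, fun f hf hfx => (mem_formsWith.1 (h3 f hf hfx)).2, fun f hfx => ?_, fun i hxi => ?_⟩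
  · by_cases h0 : #(zeros v f) = 0
    · exact Or.inr h0
    · obtain ⟨i, hi⟩ := card_pos.1 (Nat.pos_of_ne_zero h0)
      have hf0 : f ≠ 0 := by
        rintro rfl
        exact hfx rfl
      refine Or.inl (((card_zeros_of_mem hρ hV hι hdvd hR i).1 f hf0
        (mem_zeros.1 hi)).resolve_left fun h => hfx ?_)
      have : f ∈ killers (Submodule.span F {x}) := h4 ▸ mem_formsWith.2 ⟨hf0, h⟩
      exact (mem_killers_span.1 this).2
  · have h5 := (card_zeros_of_mem hρ hV hι hdvd hR i).2
    -- A member has only one ρ-line through it, whereas `x` has at least two.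
    have h6 : formsWithAt F v ρ (v i) = formsWithAt F v ρ x := by
      obtain ⟨c, rfl⟩ := Submodule.mem_span_singleton.1 hxi
      have hc : c ≠ 0 := fun h => hx (by simp [h])
      ext f
      simp [mem_formsWithAt, hc]
    rw [h6] at h5
    omega

end Plane

/-! ### Coincidences between vectors spanned by pairs of arc points -/

section Collisions

open Module Finset
open scoped Classical

variable {F V ι : Type*} [Field F] [AddCommGroup V] [Module F V] [Fintype ι] [Fintype F]

/-- The vectors `a • v i + b • v j` with `i ≠ j` and nonzero scalars, as a family. -/
def pairVec (v : ι → V) (p : (ι × ι) × Fˣ × Fˣ) : V :=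
  (p.2.1 : F) • v p.1.1 + (p.2.2 : F) • v p.1.2

variable (F ι) in
/-- The index set of the vectors on two points of a family, but on neither of the two. -/
noncomputable def pairSet : Finset ((ι × ι) × Fˣ × Fˣ) :=
  (univ : Finset ι).offDiag ×ˢ univ

/-- Any three vectors of the family with distinct indices are linearly independent. -/
def ThreeIndep (F : Type*) {V ι : Type*} [Field F] [AddCommGroup V] [Module F V] (v : ι → V) :
    Prop :=
  ∀ i j k, i ≠ j → i ≠ k → j ≠ k → ∀ a b c : F, a • v i + b • v j + c • v k = 0 →
    a = 0 ∧ b = 0 ∧ c = 0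

lemma card_pairSet : #(pairSet F ι) =
    (Fintype.card ι * Fintype.card ι - Fintype.card ι) * (Fintype.card F - 1) ^ 2 := by
  rw [pairSet, card_product, offDiag_card, card_univ, card_univ, Fintype.card_prod,
    Fintype.card_units, sq]

omit [Fintype F] in
lemma ThreeIndep.pair {v : ι → V} (h : ThreeIndep F v) (h3 : 3 ≤ Fintype.card ι) {i j : ι}
    (hij : i ≠ j) {a b : F} (hab : a • v i + b • v j = 0) : a = 0 ∧ b = 0 := by
  obtain ⟨k, hk⟩ : ∃ k, k ∉ ({i, j} : Finset ι) := by
    by_contra! hcon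
    have h1 : (univ : Finset ι) ⊆ {i, j} := fun k _ => hcon k
    have h2 := card_le_card h1
    have h4 : #({i, j} : Finset ι) ≤ 2 := card_le_two
    rw [card_univ] at h2
    omega
  simp only [mem_insert, mem_singleton, not_or] at hk
  have := h i j k hij (Ne.symm hk.1) (Ne.symm hk.2) a b 0 (by simpa using hab)
  exact ⟨this.1, this.2.1⟩

/-- Coincidences between vectors on two pairs of points that are not disjoint. -/
lemma card_meeting_collisions_le {v : ι → V} (h : ThreeIndep F v) (h3 : 3 ≤ Fintype.card ι) :
    #((pairSet F ι ×ˢ pairSet F ι).filter fun r => pairVec v r.1 = pairVec v r.2 ∧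
      ¬ Disjoint ({r.1.1.1, r.1.1.2} : Finset ι) {r.2.1.1, r.2.1.2}) ≤ 2 * #(pairSet F ι) := by
  -- When the pairs share an index, three-independence forces equal pairs with equal scalars, in the
  -- same or in swapped order.
  have hsub : ((pairSet F ι ×ˢ pairSet F ι).filter fun r => pairVec v r.1 = pairVec v r.2 ∧
      ¬ Disjoint ({r.1.1.1, r.1.1.2} : Finset ι) {r.2.1.1, r.2.1.2}) ⊆
      (pairSet F ι).image (fun p => (p, p)) ∪
        (pairSet F ι).image (fun p => (p, ((p.1.2, p.1.1), (p.2.2, p.2.1)))) := by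
    rintro ⟨⟨⟨i, j⟩, a, b⟩, ⟨⟨k, l⟩, c, d⟩⟩ hr
    simp only [pairSet, pairVec, mem_filter, mem_product, mem_offDiag, mem_univ, true_and,
      and_true, disjoint_insert_left, disjoint_singleton_left, mem_insert, mem_singleton] at hr
    obtain ⟨⟨hij, hkl⟩, hE, hd⟩ := hr
    simp only [mem_union, mem_image, pairSet, mem_product, mem_offDiag, mem_univ, true_and,
      and_true, Prod.mk.injEq, Prod.exists]
    have key : ∀ {x y z : ι} {e₁ e₂ e₃ : F}, x ≠ y → x ≠ z → y ≠ z → e₂ ≠ 0 →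
        e₁ • v x + e₂ • v y + e₃ • v z = 0 → False := fun hxy hxz hyz h2 hE =>
      h2 (h _ _ _ hxy hxz hyz _ _ _ hE).2.1
    by_cases hik : i = k
    · subst hik
      by_cases hjl : j = l
      · subst hjl
        left
        obtain ⟨h1, h2⟩ := h.pair h3 hij (a := (a - c : F)) (b := (b - d : F)) (by
          rw [sub_smul, sub_smul, sub_add_sub_comm, hE, sub_self])
        exact ⟨i, j, a, b, hij, ⟨⟨rfl, rfl⟩, rfl, rfl⟩, ⟨rfl, rfl⟩, Units.ext (sub_eq_zero.1 h1),
          Units.ext (sub_eq_zero.1 h2)⟩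
      · refine (key hij hkl hjl b.ne_zero (e₁ := (a - c : F)) (e₃ := -d) ?_).elim
        rw [sub_smul, neg_smul]
        linear_combination (norm := module) hE
    · by_cases hil : i = l
      · subst hil
        by_cases hjk : j = k
        · subst hjk
          right
          obtain ⟨h1, h2⟩ := h.pair h3 hij (a := (a - d : F)) (b := (b - c : F)) (by
            rw [sub_smul, sub_smul]
            linear_combination (norm := module) hE)
          exact ⟨i, j, a, b, hij, ⟨⟨rfl, rfl⟩, rfl, rfl⟩, ⟨rfl, rfl⟩, Units.ext (sub_eq_zero.1 h2),
            Units.ext (sub_eq_zero.1 h1)⟩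
        · refine (key hij (Ne.symm hkl) hjk b.ne_zero (e₁ := (a - d : F)) (e₃ := -c) ?_).elim
          rw [sub_smul, neg_smul]
          linear_combination (norm := module) hE
      · by_cases hjk : j = k
        · subst hjk
          refine (key (Ne.symm hij) hkl hil a.ne_zero (e₁ := (b - c : F)) (e₃ := -d) ?_).elim
          rw [sub_smul, neg_smul]
          linear_combination (norm := module) hE
        · by_cases hjl : j = l
          · subst hjl
            refine (key (Ne.symm hij) (Ne.symm hkl) hik a.ne_zero (e₁ := (b - d : F))
              (e₃ := -c) ?_).elim
            rw [sub_smul, neg_smul]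
            linear_combination (norm := module) hE
          · tauto
  refine (card_le_card hsub).trans ((card_union_le _ _).trans ?_)
  have h1 := card_image_le (s := pairSet F ι) (f := fun p => (p, p))
  have h2 := card_image_le (s := pairSet F ι)
    (f := fun p => (p, (((p.1.2, p.1.1), (p.2.2, p.2.1)) : (ι × ι) × Fˣ × Fˣ)))
  omega

omit [Fintype F] in
lemma exists_form_three (hV : 4 ≤ finrank F V) (x y z : V) :
    ∃ f : Dual F V, f ≠ 0 ∧ f x = 0 ∧ f y = 0 ∧ f z = 0 := by
  have h1 : finrank F (Submodule.span F ({x, y, z} : Set V)) ≤ 3 := by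
    have := finrank_span_finset_le_card (R := F) ({x, y, z} : Finset V)
    rw [Set.finrank] at this
    rw [show ({x, y, z} : Set V) = (({x, y, z} : Finset V) : Set V) by simp]
    exact this.trans card_le_three
  have h2 : Submodule.span F ({x, y, z} : Set V) < ⊤ := by
    refine lt_top_iff_ne_top.2 fun h => ?_
    rw [h, finrank_top] at h1
    omega
  obtain ⟨f, hf, hle⟩ := Submodule.exists_le_ker_of_lt_top _ h2
  exact ⟨f, hf, hle (Submodule.subset_span (by simp)), hle (Submodule.subset_span (by simp)),
    hle (Submodule.subset_span (by simp))⟩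

/-- Coincidences between vectors on two disjoint pairs of points. -/
lemma card_disjoint_collisions_le {v : ι → V} (h : ThreeIndep F v) (hV : finrank F V = 4) {R : ℕ}
    (hR : ∀ f : Dual F V, f ≠ 0 → #(zeros v f) ≤ R + 3) :
    #((pairSet F ι ×ˢ pairSet F ι).filter fun r => pairVec v r.1 = pairVec v r.2 ∧
      Disjoint ({r.1.1.1, r.1.1.2} : Finset ι) {r.2.1.1, r.2.1.2}) ≤
      R * (Fintype.card ι - 2) *
        ((Fintype.card ι * Fintype.card ι - Fintype.card ι) * (Fintype.card F - 1)) := by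
  set D := (pairSet F ι ×ˢ pairSet F ι).filter fun r => pairVec v r.1 = pairVec v r.2 ∧
      Disjoint ({r.1.1.1, r.1.1.2} : Finset ι) {r.2.1.1, r.2.1.2} with hD
  have hmem : ∀ i j a b k l c d, (((i, j), a, b), ((k, l), c, d)) ∈ D →
      i ≠ j ∧ k ≠ l ∧ i ≠ k ∧ i ≠ l ∧ j ≠ k ∧ j ≠ l ∧
        (a : F) • v i + (b : F) • v j = (c : F) • v k + (d : F) • v l := by
    intro i j a b k l c d hr
    simp only [hD, pairSet, pairVec, mem_filter, mem_product, mem_offDiag, mem_univ, true_and,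
      and_true, disjoint_insert_left, disjoint_singleton_left, mem_insert, mem_singleton] at hr
    tauto
  have hunit : #((univ : Finset ι).offDiag ×ˢ (univ : Finset Fˣ)) =
      (Fintype.card ι * Fintype.card ι - Fintype.card ι) * (Fintype.card F - 1) := by
    rw [card_product, offDiag_card, card_univ, card_univ, Fintype.card_units]
  rw [← hunit]
  -- Choose i, j and the scalar a, then k. The plane on i, j, k must contain l, leaving at most `R`
  -- choices, and the remaining scalars are then forced.
  refine card_le_mul_card_image_of_maps_to (f := fun r => (r.1.1, r.1.2.1)) ?_ _ ?_
  · rintro ⟨⟨⟨i, j⟩, a, b⟩, ⟨⟨k, l⟩, c, d⟩⟩ hr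
    simpa using (hmem _ _ _ _ _ _ _ _ hr).1
  rintro ⟨⟨i, j⟩, a⟩ hij
  replace hij : i ≠ j := by simpa using hij
  have hc2 : #(univ \ ({i, j} : Finset ι)) = Fintype.card ι - 2 := by
    rw [card_sdiff_of_subset (subset_univ _), card_univ, card_pair hij]
  rw [← hc2]
  refine card_le_mul_card_image_of_maps_to (f := fun r => r.2.1.1) ?_ _ ?_
  · rintro ⟨⟨⟨i', j'⟩, a', b⟩, ⟨⟨k, l⟩, c, d⟩⟩ hr
    rw [mem_filter] at hr
    simp only [Prod.mk.injEq] at hr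
    obtain ⟨hr, ⟨rfl, rfl⟩, rfl⟩ := hr
    have := hmem _ _ _ _ _ _ _ _ hr
    simp only [mem_sdiff, mem_univ, true_and, mem_insert, mem_singleton]
    tauto
  intro k hk
  simp only [mem_sdiff, mem_univ, true_and, mem_insert, mem_singleton, not_or] at hk
  obtain ⟨f, hf, hfi, hfj, hfk⟩ := exists_form_three (F := F) hV.ge (v i) (v j) (v k)
  have hcard : #(zeros v f \ {i, j, k}) ≤ R := by
    rw [card_sdiff_of_subset (by
      intro x hx
      simp only [mem_insert, mem_singleton] at hx
      rcases hx with rfl | rfl | rfl <;> simpa [mem_zeros]),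
      card_eq_three.2 ⟨i, j, k, hij, Ne.symm hk.1, Ne.symm hk.2, rfl⟩]
    have := hR f hf
    omega
  refine (card_le_card_of_injOn (fun r => r.2.1.2) ?_ ?_).trans hcard
  · rintro ⟨⟨⟨i', j'⟩, a', b⟩, ⟨⟨k', l⟩, c, d⟩⟩ hr
    simp only [coe_filter, mem_filter, Prod.mk.injEq, Set.mem_ofPred_eq] at hr
    obtain ⟨⟨hr, ⟨rfl, rfl⟩, rfl⟩, rfl⟩ := hr
    obtain ⟨-, hkl, -, hil, -, hjl, hE⟩ := hmem _ _ _ _ _ _ _ _ hr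
    have hE' := congrArg f hE
    have hfl : f (v l) = 0 := by simpa [hfi, hfj, hfk] using hE'.symm
    simp only [coe_sdiff, Set.mem_sdiff, mem_coe, mem_zeros, hfl, mem_insert, mem_singleton]
    tauto
  · rintro ⟨⟨⟨i₁, j₁⟩, a₁, b⟩, ⟨⟨k₁, l⟩, c, d⟩⟩ hr ⟨⟨⟨i₂, j₂⟩, a₂, b'⟩, ⟨⟨k₂, l'⟩, c', d'⟩⟩ hr' hl
    simp only [coe_filter, mem_filter, Prod.mk.injEq, Set.mem_ofPred_eq] at hr hr'
    obtain ⟨⟨hr, ⟨rfl, rfl⟩, rfl⟩, rfl⟩ := hr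
    obtain ⟨⟨hr', ⟨rfl, rfl⟩, rfl⟩, rfl⟩ := hr'
    obtain rfl : l = l' := hl
    obtain ⟨-, hkl, -, hil, hjk, hjl, hE⟩ := hmem _ _ _ _ _ _ _ _ hr
    obtain ⟨-, -, -, -, -, -, hE'⟩ := hmem _ _ _ _ _ _ _ _ hr'
    -- With a fixed, subtracting the two relations eliminates `v i`.
    obtain ⟨h1, h2, h4⟩ := h _ _ _ hjk hjl hkl (b - b' : F) (c' - c) (d' - d) (by
      simp only [sub_smul]
      linear_combination (norm := module) hE - hE')
    rw [sub_eq_zero] at h1 h2 h4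
    simp [Units.ext h1, Units.ext h2, Units.ext h4]

end Collisions

/-! ### Maximal arcs in projective three-space do not exist -/

section Variance

open Module Finset
open scoped Classical

/-- `N` bounds the vectors off the arc and `C` the coincidences. Conclusion: the second moment is
too small for Cauchy–Schwarz. -/
lemma variance_inequality {q ρ m p N C : ℕ} (hρ : 2 ≤ ρ) (hq : 2 * (ρ + 1) ≤ q) (hp : q = p + 1)
    (hm : m = ρ * (q + 1) + 2) (hN : N + (m * p + 1) ≤ q ^ 4)
    (hC : C ≤ 2 * ((m * m - m) * p ^ 2) + (ρ - 1) * (m - 2) * ((m * m - m) * p)) :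
    N * C < ((m * m - m) * p ^ 2) ^ 2 := by
  have hmm : m ≤ m * m := Nat.le_mul_self m
  have hm2 : m - 2 = ρ * (q + 1) := by omega
  obtain ⟨M, hM⟩ : ∃ M, m * m - m = M := ⟨_, rfl⟩
  have hM' : M + m = m * m := by omega
  rw [hm2, hM] at hC
  rw [hM]
  have hM0 : 0 < M := by nlinarith
  have hp0 : 0 < p := by omega
  zify [show 1 ≤ ρ by omega] at *
  set N' : ℤ := q ^ 3 + q ^ 2 + q + 1 - m with hN'
  set B : ℤ := 2 * p + ρ * (q + 1) * (ρ - 1) with hB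
  have h1 : (N : ℤ) ≤ p * N' := by
    rw [hN', hp] at *
    linarith
  have h2 : (C : ℤ) ≤ M * p * B := by
    rw [hB]
    linarith
  -- Substituting ρ = 2 + a and q = 2(ρ + 1) + b turns the difference into a polynomial in a, b that
  -- is visibly positive.
  have h3 : N' * B < M * p ^ 2 := by
    obtain ⟨a, ha⟩ := Int.le.dest hρ
    obtain ⟨b, hb⟩ := Int.le.dest hq
    have hMe : (M : ℤ) = m * m - m := by linarith
    have hpe : (p : ℤ) = q - 1 := by linarith
    rw [hN', hB, hMe, hpe, hm, ← hb, ← ha, ← sub_pos]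
    ring_nf
    positivity
  have hN0 : (0 : ℤ) ≤ N := by positivity
  have hC0 : (0 : ℤ) ≤ C := by positivity
  calc (N * C : ℤ) ≤ (p * N') * (M * p * B) := mul_le_mul h1 h2 hC0 (hN0.trans h1)
    _ = (M * p ^ 2) * (N' * B) := by ring
    _ < (M * p ^ 2) * (M * p ^ 2) := by
      refine mul_lt_mul_of_pos_left h3 ?_
      positivity
    _ = _ := by ring

variable {F V ι : Type*} [Field F] [AddCommGroup V] [Module F V] [Fintype ι] [Fintype F]

/-- The vectors that are not multiples of a member of the family. -/
lemma card_off_le [Fintype V] {v : ι → V} (h : ThreeIndep F v) (h3 : 3 ≤ Fintype.card ι) :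
    #(univ.filter fun z : V => ∀ (i : ι) (c : F), z ≠ c • v i) +
      (Fintype.card ι * (Fintype.card F - 1) + 1) ≤ Fintype.card V := by
  -- `none` stands for the zero vector, which accounts for the + 1.
  set φ : Option (ι × Fˣ) → V := fun x => x.elim 0 fun y => (y.2 : F) • v y.1 with hφ
  have hv : ∀ i, v i ≠ 0 := by
    intro i hi
    have : Nontrivial ι := Fintype.one_lt_card_iff_nontrivial.1 (by omega)
    obtain ⟨j, hj⟩ := exists_ne i
    exact one_ne_zero (h.pair h3 hj.symm (a := (1 : F)) (b := 0) (by simp [hi])).1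
  have hinj : Function.Injective φ := by
    rintro (_ | ⟨i, c⟩) (_ | ⟨j, d⟩) hE
    · rfl
    · simp [hφ, eq_comm, hv] at hE
    · simp [hφ, hv] at hE
    · simp only [hφ, Option.elim_some] at hE
      by_cases hij : i = j
      · subst hij
        rw [Units.ext (smul_left_injective F (hv i) hE)]
      · have := (h.pair h3 hij (a := (c : F)) (b := -d) (by rw [hE]; module)).1
        exact (c.ne_zero this).elim
  have h1 : #((univ : Finset (Option (ι × Fˣ))).image φ) =
      Fintype.card ι * (Fintype.card F - 1) + 1 := by
    rw [card_image_of_injective _ hinj, card_univ, Fintype.card_option, Fintype.card_prod,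
      Fintype.card_units]
  rw [← h1, ← card_union_of_disjoint]
  · exact card_le_univ _
  · rw [disjoint_left]
    intro z hz hz'
    rw [mem_filter] at hz
    obtain ⟨x, -, rfl⟩ := mem_image.1 hz'
    have : Nonempty ι := Fintype.card_pos_iff.1 (by omega)
    rcases x with _ | ⟨i, c⟩
    · exact hz.2 (Classical.arbitrary ι) 0 (by simp [hφ])
    · exact hz.2 i c (by simp [hφ])

variable [FiniteDimensional F V]

/-- A family that satisfies the arc condition with the parameters of a maximal arc in a space of
dimension four has no three dependent members. -/
lemma threeIndep_of_zeros_le {v : ι → V} {ρ : ℕ} (hV : finrank F V = 4)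
    (hι : ρ * (Fintype.card F + 1) + 1 ≤ Fintype.card ι)
    (hR : ∀ f : Dual F V, f ≠ 0 → #(zeros v f) ≤ ρ + 2) : ThreeIndep F v := by
  have : Finite V := Module.finite_of_finite F
  have : Finite (Dual F V) := Module.finite_of_finite F
  have : Fintype (Dual F V) := Fintype.ofFinite _
  intro i j k hij hik hjk a b c habc
  by_contra hne
  have hW : finrank F (Submodule.span F (Set.range ![v i, v j, v k])) ≤ 2 := by
    by_contra! h
    have hli : LinearIndependent F ![v i, v j, v k] := by
      rw [linearIndependent_iff_card_le_finrank_span]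
      exact h
    rw [Fintype.linearIndependent_iff] at hli
    have := hli ![a, b, c] (by simpa [Fin.sum_univ_three] using habc)
    exact hne ⟨this 0, this 1, this 2⟩
  obtain ⟨W, hWle, hWr⟩ := exists_finrank_eq_of_le _ hW (by omega)
  -- For w members in `W` this gives qw ≤ 2q + 1, hence w ≤ 2.
  have h1 := card_mem_codim_two v hR (W := W) (by omega)
  have h2 : ({i, j, k} : Finset ι) ⊆ univ.filter fun l => v l ∈ W := by
    intro l hl
    simp only [mem_insert, mem_singleton] at hl
    simp only [mem_filter, mem_univ, true_and]
    rcases hl with rfl | rfl | rfl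
    · exact hWle (Submodule.subset_span ⟨0, rfl⟩)
    · exact hWle (Submodule.subset_span ⟨1, rfl⟩)
    · exact hWle (Submodule.subset_span ⟨2, rfl⟩)
  have h3 := card_le_card h2
  rw [card_eq_three.2 ⟨i, j, k, hij, hik, hjk, rfl⟩] at h3
  have hq : 1 < Fintype.card F := Fintype.one_lt_card
  nlinarith

/-- There are no maximal arcs with `0 < s < q - 2` and `2 (s + 2) ≤ q` in projective three-space:
the numbers of secant lines through the points off the arc would have negative variance. -/
theorem no_maximal_family {v : ι → V} {ρ : ℕ} (hV : finrank F V = 4) (hρ : 2 ≤ ρ)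
    (hq : 2 * (ρ + 1) ≤ Fintype.card F) (hι : Fintype.card ι = ρ * (Fintype.card F + 1) + 2)
    (hR : ∀ f : Dual F V, f ≠ 0 → #(zeros v f) ≤ ρ + 2) : False := by
  have : Finite V := Module.finite_of_finite F
  have : Fintype V := Fintype.ofFinite _
  have h := threeIndep_of_zeros_le hV (by omega) hR
  have h3 : 3 ≤ Fintype.card ι := by rw [hι]; nlinarith
  set O := univ.filter fun z : V => ∀ (i : ι) (c : F), z ≠ c • v i with hO
  set E := (pairSet F ι ×ˢ pairSet F ι).filter fun r => pairVec v r.1 = pairVec v r.2 with hE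
  have hmaps : ∀ p ∈ pairSet F ι, pairVec v p ∈ O := by
    rintro ⟨⟨i, j⟩, a, b⟩ hp
    have hij : i ≠ j := by simpa [pairSet] using hp
    simp only [hO, mem_filter, mem_univ, true_and, pairVec]
    intro k c hk
    by_cases hik : k = i
    · subst hik
      exact b.ne_zero (h.pair h3 hij (a := (a - c : F)) (b := b) (by
        linear_combination (norm := module) hk)).2
    · by_cases hjk : k = j
      · subst hjk
        exact a.ne_zero (h.pair h3 hij (a := (a : F)) (b := (b - c : F)) (by
          linear_combination (norm := module) hk)).1
      · exact a.ne_zero (h i j k hij (Ne.symm hik) (Ne.symm hjk) a b (-c) (by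
          linear_combination (norm := module) hk)).1
  have hsum := card_eq_sum_card_fiberwise hmaps
  -- The coincidences are the second moment of the fibre sizes of `pairVec`, and `pairSet` is the
  -- first.
  have hsq : #E = ∑ z ∈ O, #((pairSet F ι).filter fun p => pairVec v p = z) ^ 2 := by
    rw [card_eq_sum_card_fiberwise (f := fun r => pairVec v r.1) (t := O)
      (fun r hr => hmaps _ (mem_product.1 (mem_filter.1 hr).1).1)]
    refine sum_congr rfl fun z _ => ?_
    rw [sq, ← card_product]
    congr 1
    ext ⟨r, r'⟩
    simp only [mem_filter, mem_product]
    constructor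
    · rintro ⟨⟨⟨h1, h2⟩, h4⟩, h5⟩
      exact ⟨⟨h1, h5⟩, h2, h4 ▸ h5⟩
    · rintro ⟨⟨h1, h5⟩, h2, h4⟩
      exact ⟨⟨⟨h1, h2⟩, h5.trans h4.symm⟩, h5⟩
  have hcs := sq_sum_le_card_mul_sum_sq (s := O)
    (f := fun z => #((pairSet F ι).filter fun p => pairVec v p = z))
  rw [← hsum, ← hsq] at hcs
  have hEle : #E ≤ 2 * #(pairSet F ι) + (ρ - 1) * (Fintype.card ι - 2) *
      ((Fintype.card ι * Fintype.card ι - Fintype.card ι) * (Fintype.card F - 1)) := by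
    rw [← card_filter_add_card_filter_not (s := E) (fun r =>
      Disjoint ({r.1.1.1, r.1.1.2} : Finset ι) {r.2.1.1, r.2.1.2}), add_comm, hE, filter_filter,
      filter_filter]
    exact add_le_add (card_meeting_collisions_le h h3)
      (card_disjoint_collisions_le h hV (R := ρ - 1) fun f hf => (hR f hf).trans (by omega))
  have hOle := card_off_le h h3
  rw [card_eq_pow_finrank (K := F) (V := V), hV] at hOle
  rw [card_pairSet] at hEle hcs
  have hq1 : 1 ≤ Fintype.card F := Fintype.card_pos
  exact (variance_inequality hρ hq (by omega) hι hOle hEle).not_ge hcs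

end Variance

/-! ### Almost maximal arcs beyond the plane -/

section Nonexistence

open Module Finset
open scoped Classical

universe u w

/-- Lines in a space of dimension four that meet pairwise and do not lie in a hyperplane have a
point in common. -/
lemma exists_common_point {F V ι : Type*} [Field F] [AddCommGroup V] [Module F V]
    [FiniteDimensional F V] [Nontrivial ι] {L : ι → Submodule F V}
    (hL : ∀ i, finrank F (L i) = 2) (hinj : Function.Injective L)
    (hmeet : ∀ i j, i ≠ j → L i ⊓ L j ≠ ⊥)
    (hspan : ∀ U : Submodule F V, finrank F U ≤ 3 → ∃ m, ¬ L m ≤ U) :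
    ∃ x : V, x ≠ 0 ∧ ∀ i, x ∈ L i := by
  have hinf : ∀ i j, i ≠ j → finrank F ↥(L i ⊓ L j) = 1 := by
    intro i j hij
    have h1 := Submodule.one_le_finrank_iff.2 (hmeet i j hij)
    by_contra hne
    have h2 : L i ⊓ L j = L i := Submodule.eq_of_le_of_finrank_le inf_le_left (by rw [hL]; omega)
    have h3 : L i ⊓ L j = L j := Submodule.eq_of_le_of_finrank_le inf_le_right (by rw [hL]; omega)
    exact hij (hinj (h2.symm.trans h3))
  have hsup : ∀ i j, i ≠ j → finrank F ↥(L i ⊔ L j) = 3 := by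
    intro i j hij
    have := Submodule.finrank_sup_add_finrank_inf_eq (L i) (L j)
    rw [hinf i j hij, hL, hL] at this
    omega
  -- A line off the plane `L i ⊔ L j` meets `L i` and `L j` in the same point, otherwise it would
  -- lie in that plane.
  have key : ∀ i j, i ≠ j → ∀ x, x ∈ L i → x ∈ L j → ∀ l, ¬ L l ≤ L i ⊔ L j → x ∈ L l := by
    intro i j hij x hxi hxj l hl
    have hli : l ≠ i := fun h => hl (h ▸ le_sup_left)
    have hlj : l ≠ j := fun h => hl (h ▸ le_sup_right)
    obtain ⟨a, ha, ha0⟩ := Submodule.exists_mem_ne_zero_of_ne_bot (hmeet l i hli)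
    obtain ⟨b, hb, hb0⟩ := Submodule.exists_mem_ne_zero_of_ne_bot (hmeet l j hlj)
    by_cases haj : a ∈ L j
    · have h1 : Submodule.span F {a} = L i ⊓ L j := by
        refine Submodule.eq_of_le_of_finrank_le ?_ ?_
        · rw [Submodule.span_singleton_le_iff_mem]
          exact ⟨ha.2, haj⟩
        · rw [hinf i j hij, finrank_span_singleton ha0]
      have h2 : x ∈ Submodule.span F {a} := h1 ▸ ⟨hxi, hxj⟩
      exact (Submodule.span_singleton_le_iff_mem _ _).2 ha.1 h2
    · have hab : a ∉ Submodule.span F {b} := fun h =>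
        haj ((Submodule.span_singleton_le_iff_mem _ _).2 hb.2 h)
      have h1 : Submodule.span F {b} ⊔ Submodule.span F {a} = L l := by
        refine Submodule.eq_of_le_of_finrank_le (sup_le ?_ ?_) ?_
        · exact (Submodule.span_singleton_le_iff_mem _ _).2 hb.1
        · exact (Submodule.span_singleton_le_iff_mem _ _).2 ha.1
        · rw [finrank_sup_span_singleton hab, finrank_span_singleton hb0, hL]
      refine (hl ?_).elim
      rw [← h1]
      refine sup_le ?_ ?_
      · exact ((Submodule.span_singleton_le_iff_mem _ _).2 hb.2).trans le_sup_right
      · exact ((Submodule.span_singleton_le_iff_mem _ _).2 ha.2).trans le_sup_left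
  obtain ⟨i, j, hij⟩ := exists_pair_ne ι
  obtain ⟨x, hx, hx0⟩ := Submodule.exists_mem_ne_zero_of_ne_bot (hmeet i j hij)
  obtain ⟨m, hm⟩ := hspan (L i ⊔ L j) (hsup i j hij).le
  have hxm := key i j hij x hx.1 hx.2 m hm
  have him : i ≠ m := fun h => hm (h ▸ le_sup_left)
  refine ⟨x, hx0, fun l => ?_⟩
  by_cases h1 : L l ≤ L i ⊔ L j
  swap
  · exact key i j hij x hx.1 hx.2 l h1
  by_cases h2 : L l ≤ L i ⊔ L m
  swap
  · exact key i m him x hx.1 hxm l h2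
  -- A line inside both planes equals their intersection, which contains `x`.
  have h3 : (L i ⊔ L j) ⊓ (L i ⊔ L m) < L i ⊔ L m := by
    refine lt_of_le_of_ne inf_le_right fun h => hm ?_
    exact le_sup_right.trans (h ▸ inf_le_left)
  have h4 := Submodule.finrank_lt_finrank_of_lt h3
  rw [hsup i m him] at h4
  have h5 : L l = (L i ⊔ L j) ⊓ (L i ⊔ L m) :=
    Submodule.eq_of_le_of_finrank_le (le_inf h1 h2) (by rw [hL]; omega)
  rw [h5]
  exact ⟨le_sup_left (a := L i) hx.1, le_sup_left (a := L i) hx.1⟩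

/-- The projection of a family from one of its members. -/
def projFamily {F V ι : Type*} [Field F] [AddCommGroup V] [Module F V] (v : ι → V) (i : ι) :
    {j // j ≠ i} → V ⧸ Submodule.span F {v i} :=
  fun j => (Submodule.span F {v i}).mkQ (v j)

lemma card_zeros_projFamily {F V ι : Type*} [Field F] [AddCommGroup V] [Module F V] [Fintype ι]
    (v : ι → V) (i : ι) (f : Dual F (V ⧸ Submodule.span F {v i})) :
    #(zeros v (f ∘ₗ (Submodule.span F {v i}).mkQ)) = #(zeros (projFamily (F := F) v i) f) + 1 := by
  have h1 : zeros v (f ∘ₗ (Submodule.span F {v i}).mkQ) =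
      insert i ((zeros (projFamily (F := F) v i) f).map (Function.Embedding.subtype _)) := by
    ext j
    by_cases hj : j = i
    · subst hj
      have : (Submodule.span F {v j}).mkQ (v j) = 0 := by
        simp [Submodule.mem_span_singleton_self]
      simp only [mem_zeros, LinearMap.comp_apply, this, map_zero, mem_insert, true_or]
    · simp [mem_zeros, hj, projFamily]
  rw [h1, card_insert_of_notMem (by simp), card_map]

lemma finrank_quotient_span_singleton {F V : Type*} [Field F] [AddCommGroup V] [Module F V]
    [FiniteDimensional F V] {x : V} (hx : x ≠ 0) :
    finrank F (V ⧸ Submodule.span F {x}) + 1 = finrank F V := by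
  rw [← Submodule.finrank_quotient_add_finrank (Submodule.span F {x}), finrank_span_singleton hx]

lemma zeros_projFamily_le {F V ι : Type*} [Field F] [AddCommGroup V] [Module F V] [Fintype ι]
    {v : ι → V} {R : ℕ} (hR : ∀ f : Dual F V, f ≠ 0 → #(zeros v f) ≤ R + 1) (i : ι)
    (f : Dual F (V ⧸ Submodule.span F {v i})) (hf : f ≠ 0) :
    #(zeros (projFamily (F := F) v i) f) ≤ R := by
  have h1 : f ∘ₗ (Submodule.span F {v i}).mkQ ≠ 0 := by
    intro h
    refine hf (LinearMap.ext fun y => ?_)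
    obtain ⟨x, rfl⟩ := Submodule.mkQ_surjective _ y
    exact LinearMap.congr_fun h x
  have h2 := hR _ h1
  rw [card_zeros_projFamily] at h2
  omega

lemma card_zeros_option {F V ι : Type*} [Field F] [AddCommGroup V] [Module F V] [Fintype ι]
    (v : ι → V) (x : V) (f : Dual F V) :
    #(zeros (fun o : Option ι => o.elim x v) f) = #(zeros v f) + if f x = 0 then 1 else 0 := by
  rw [zeros, zeros, card_filter, card_filter, Fintype.sum_option, add_comm]
  rfl

section Four

variable {F V ι : Type*} [Field F] [AddCommGroup V] [Module F V] [Fintype ι] [Fintype F]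
  [FiniteDimensional F V]

/-- The projection from `v i` is planar with ρ(q + 1) members. Its nucleus lifts to `x`, determined
only modulo `v i`; the centre adds one to each count. -/
lemma exists_local_nucleus {v : ι → V} {ρ : ℕ} (hV : finrank F V = 4) (hρ : 2 ≤ ρ)
    (hdvd : ρ + 1 ∣ Fintype.card F) (hι : Fintype.card ι = ρ * (Fintype.card F + 1) + 1)
    (hR : ∀ f : Dual F V, f ≠ 0 → #(zeros v f) ≤ ρ + 2) {i : ι} (hi : v i ≠ 0) :
    ∃ x : V, x ∉ Submodule.span F {v i} ∧
      (∀ f : Dual F V, f ≠ 0 → f (v i) = 0 → f x = 0 → #(zeros v f) = ρ + 1) ∧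
      (∀ f : Dual F V, f (v i) = 0 → f x ≠ 0 → #(zeros v f) = ρ + 2 ∨ #(zeros v f) = 1) ∧
      ∀ j, j ≠ i → ∀ a b : F, x ≠ a • v i + b • v j := by
  set W := Submodule.span F {v i} with hW
  have hWr : finrank F (V ⧸ W) = 3 := by
    have := finrank_quotient_span_singleton (F := F) hi
    rw [← hW] at this
    omega
  have : Finite (V ⧸ W) := Module.finite_of_finite F
  have : Fintype (V ⧸ W) := Fintype.ofFinite _
  have : Finite (Dual F (V ⧸ W)) := Module.finite_of_finite F
  have : Fintype (Dual F (V ⧸ W)) := Fintype.ofFinite _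
  obtain ⟨y, hy0, hy1, hy2, hy3⟩ := exists_nucleus (F := F) (v := projFamily (F := F) v i) (ρ := ρ)
    (by omega) hWr (by
      rw [Fintype.card_subtype_compl, Fintype.card_subtype_eq]
      omega) hdvd (zeros_projFamily_le hR i)
  obtain ⟨x, rfl⟩ := Submodule.mkQ_surjective _ y
  have hlift : ∀ f : Dual F V, f (v i) = 0 → ∃ f' : Dual F (V ⧸ W), f' ∘ₗ W.mkQ = f := by
    intro f hf
    exact ⟨W.liftQ f (by rw [hW, Submodule.span_singleton_le_iff_mem]; exact hf),
      Submodule.liftQ_mkQ _ _ _⟩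
  refine ⟨x, fun hx => hy0 (by simpa using hx), ?_, ?_, ?_⟩
  · intro f hf hfi hfx
    obtain ⟨f', rfl⟩ := hlift f hfi
    rw [card_zeros_projFamily, hy1 f' (fun h => hf (by rw [h, LinearMap.zero_comp])) hfx]
  · intro f hfi hfx
    obtain ⟨f', rfl⟩ := hlift f hfi
    rw [card_zeros_projFamily]
    rcases hy2 f' hfx with h | h <;> omega
  · intro j hj a b hx
    refine hy3 ⟨j, hj⟩ (Submodule.mem_span_singleton.2 ⟨b, ?_⟩)
    have : W.mkQ (v i) = 0 := by simp [hW, Submodule.mem_span_singleton_self]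
    rw [hx, map_add, map_smul, this, smul_zero, zero_add, map_smul]
    rfl

/-- A family in a space of dimension four with the parameters of an arc that is one point short of
being maximal can be extended to one with the parameters of a maximal arc. -/
lemma exists_extension {v : ι → V} {ρ : ℕ} (hV : finrank F V = 4) (hρ : 2 ≤ ρ)
    (hdvd : ρ + 1 ∣ Fintype.card F) (hι : Fintype.card ι = ρ * (Fintype.card F + 1) + 1)
    (hR : ∀ f : Dual F V, f ≠ 0 → #(zeros v f) ≤ ρ + 2) :
    ∃ x : V, ∀ f : Dual F V, f ≠ 0 → #(zeros (fun o : Option ι => o.elim x v) f) ≤ ρ + 2 := by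
  have hq : 1 < Fintype.card F := Fintype.one_lt_card
  have h := threeIndep_of_zeros_le hV hι.ge hR
  have h3 : ρ + 2 < Fintype.card ι := by rw [hι]; nlinarith
  have hnt : Nontrivial ι := Fintype.one_lt_card_iff_nontrivial.1 (by omega)
  have hpair : ∀ {i j}, i ≠ j → ∀ {a b : F}, a • v i + b • v j = 0 → a = 0 ∧ b = 0 :=
    fun hij _ _ => h.pair (by omega) hij
  have hv : ∀ i, v i ≠ 0 := by
    intro i hi
    obtain ⟨j, hj⟩ := exists_ne i
    exact one_ne_zero (hpair hj.symm (a := 1) (b := 0) (by simp [hi])).1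
  choose y hy hy1 hy2 hy3 using fun i => exists_local_nucleus hV hρ hdvd hι hR (hv i)
  set L : ι → Submodule F V := fun i => Submodule.span F {v i} ⊔ Submodule.span F {y i} with hLdef
  have hL : ∀ i, finrank F (L i) = 2 := fun i => by
    rw [hLdef, finrank_sup_span_singleton (hy i), finrank_span_singleton (hv i)]
  have hvL : ∀ i, v i ∈ L i := fun i =>
    le_sup_left (a := Submodule.span F {v i}) (Submodule.mem_span_singleton_self _)
  have hmem : ∀ {i z}, z ∈ L i → ∃ a b : F, a • v i + b • y i = z := by
    intro i z hz
    obtain ⟨z₁, h1, z₂, h2, rfl⟩ := Submodule.mem_sup.1 hz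
    obtain ⟨a, rfl⟩ := Submodule.mem_span_singleton.1 h1
    obtain ⟨b, rfl⟩ := Submodule.mem_span_singleton.1 h2
    exact ⟨a, b, rfl⟩
  have hLker : ∀ {i} {f : Dual F V}, f (v i) = 0 → f (y i) = 0 → L i ≤ LinearMap.ker f := by
    intro i f h1 h2
    refine sup_le ?_ ?_ <;> rw [Submodule.span_singleton_le_iff_mem] <;> assumption
  have hnotmem : ∀ i j, i ≠ j → v j ∉ L i := by
    intro i j hij hj
    obtain ⟨a, b, hab⟩ := hmem hj
    by_cases hb : b = 0
    · have := (hpair hij (a := a) (b := -1) (by rw [← hab, hb]; module)).2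
      exact one_ne_zero (neg_eq_zero.1 this)
    · refine hy3 i j (Ne.symm hij) (-(b⁻¹ * a)) b⁻¹ ?_
      rw [← hab, smul_add, smul_smul, smul_smul, inv_mul_cancel₀ hb]
      module
  have hinj : Function.Injective L := by
    intro i j hij
    by_contra hne
    exact hnotmem i j hne (hij ▸ hvL j)
  have hmeet : ∀ i j, i ≠ j → L i ⊓ L j ≠ ⊥ := by
    intro i j hij hbot
    -- The plane on `L i` and `v j` has ρ + 1 members, neither ρ + 2 nor 1, so it also contains `L
    -- j`; coplanar lines meet.
    obtain ⟨f, hf, hfi, hfy, hfj⟩ := exists_form_three (F := F) hV.ge (v i) (y i) (v j)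
    have h4 := hy1 i f hf hfi hfy
    have hfyj : f (y j) = 0 := by
      by_contra hne
      rcases hy2 j f hfj hne with h5 | h5 <;> omega
    have h5 := Submodule.finrank_mono (sup_le (hLker hfi hfy) (hLker hfj hfyj))
    have h6 := Submodule.finrank_sup_add_finrank_inf_eq (L i) (L j)
    have h7 := Dual.finrank_ker_add_one_of_ne_zero hf
    rw [hbot, finrank_bot, hL, hL] at h6
    omega
  have hspan : ∀ U : Submodule F V, finrank F U ≤ 3 → ∃ m, ¬ L m ≤ U := by
    intro U hU
    by_contra! hcon
    have hlt : U < ⊤ := by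
      refine lt_top_iff_ne_top.2 fun h => ?_
      rw [h, finrank_top] at hU
      omega
    obtain ⟨f, hf, hle⟩ := Submodule.exists_le_ker_of_lt_top _ hlt
    have h4 : zeros v f = univ := by
      ext i
      simp only [mem_zeros, mem_univ, iff_true]
      exact hle (hcon i (hvL i))
    have h5 := hR f hf
    rw [h4, card_univ] at h5
    omega
  obtain ⟨x, hx0, hx⟩ := exists_common_point hL hinj hmeet hspan
  refine ⟨x, fun f hf => ?_⟩
  rw [card_zeros_option]
  split_ifs with hfx
  · by_cases h0 : #(zeros v f) = 0
    · omega
    · obtain ⟨i, hi⟩ := card_pos.1 (Nat.pos_of_ne_zero h0)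
      rw [mem_zeros] at hi
      obtain ⟨a, b, hab⟩ := hmem (hx i)
      -- `x` is not proportional to `v i`, which lies on no other `L j`. So a plane on `x` and `v i`
      -- contains `L i` and has ρ + 1 members, leaving room for `x`.
      have hb : b ≠ 0 := by
        rintro rfl
        have ha : a ≠ 0 := by
          rintro rfl
          exact hx0 (by simp [← hab])
        obtain ⟨j, hj⟩ := exists_ne i
        refine hnotmem j i hj ?_
        have := hx j
        rw [← hab, zero_smul, add_zero] at this
        exact ((L j).smul_mem_iff ha).1 this
      have hfy : f (y i) = 0 := by
        rw [← hab, map_add, map_smul, map_smul, hi, smul_zero, zero_add, smul_eq_mul] at hfx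
        exact (mul_eq_zero.1 hfx).resolve_left hb
      rw [hy1 i f hf hi hfy]
  · exact hR f hf

end Four

/-- In projective spaces of dimension at least three, there are no arcs one point short of being
maximal for the parameters `s` with `0 < s < q - 2` and `s + 2 ∣ q`; here `ρ = s + 1`. -/
theorem no_almost_maximal_family {F : Type*} [Field F] [Fintype F] {ρ : ℕ} (hρ : 2 ≤ ρ)
    (hdvd : ρ + 1 ∣ Fintype.card F) (hq : 2 * (ρ + 1) ≤ Fintype.card F) (d : ℕ) :
    ∀ {V : Type u} {ι : Type w} [AddCommGroup V] [Module F V] [Fintype ι] (v : ι → V),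
      finrank F V = d + 4 → Fintype.card ι = ρ * (Fintype.card F + 1) + d + 1 →
      (∀ f : Dual F V, f ≠ 0 → #(zeros v f) ≤ d + ρ + 2) → False := by
  induction d with
  | zero =>
    intro V ι _ _ _ v hV hι hR
    have : FiniteDimensional F V := FiniteDimensional.of_finrank_pos (by omega)
    rw [zero_add] at hR
    obtain ⟨x, hx⟩ := exists_extension (by omega) hρ hdvd (by omega) hR
    exact no_maximal_family (by omega) hρ hq (by rw [Fintype.card_option]; omega) hx
  | succ d ih =>
    intro V ι _ _ _ v hV hι hR
    have : FiniteDimensional F V := FiniteDimensional.of_finrank_pos (by omega)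
    obtain ⟨i, hi⟩ : ∃ i, v i ≠ 0 := by
      by_contra! hcon
      have : Nontrivial V := Module.nontrivial_of_finrank_pos (R := F) (by omega)
      obtain ⟨f, hf⟩ := exists_ne (0 : Dual F V)
      have h1 : zeros v f = univ := by
        ext i
        simp [mem_zeros, hcon]
      have h2 := hR f hf
      rw [h1, card_univ, hι] at h2
      nlinarith
    have hW := finrank_quotient_span_singleton (F := F) hi
    -- Projection lowers the dimension, the number of members and the bound by one each.
    refine ih (projFamily (F := F) v i) (by omega) ?_
      (zeros_projFamily_le (fun f hf => (hR f hf).trans (by omega)) i)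
    rw [Fintype.card_subtype_compl, Fintype.card_subtype_eq]
    omega

end Nonexistence

/-! ### From families of vectors back to arcs -/

section Translation

open Module
open scoped Classical

variable {F V : Type*} [Field F] [AddCommGroup V] [Module F V]

lemma incident_ker {P : ℙ F V} {f : Dual F V} : Incident P (LinearMap.ker f) ↔ f P.rep = 0 := by
  rw [Incident, Projectivization.submodule_eq, Submodule.span_singleton_le_iff_mem,
    LinearMap.mem_ker]

lemma incident_mk_ker {x : V} (hx : x ≠ 0) {f : Dual F V} :
    Incident (Projectivization.mk F x hx) (LinearMap.ker f) ↔ f x = 0 := by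
  rw [Incident, Projectivization.submodule_mk, Submodule.span_singleton_le_iff_mem,
    LinearMap.mem_ker]

lemma isHyperplane_ker [FiniteDimensional F V] {f : Dual F V} (hf : f ≠ 0) :
    IsHyperplane (LinearMap.ker f) :=
  Dual.finrank_ker_add_one_of_ne_zero hf

lemma IsHyperplane.exists_ker_eq [FiniteDimensional F V] {H : Submodule F V}
    (hH : IsHyperplane H) : ∃ f : Dual F V, f ≠ 0 ∧ LinearMap.ker f = H := by
  have hlt : H < ⊤ := by
    refine lt_top_iff_ne_top.2 fun h => ?_
    rw [IsHyperplane, h, finrank_top] at hH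
    omega
  obtain ⟨f, hf, hle⟩ := Submodule.exists_le_ker_of_lt_top _ hlt
  have h1 := Dual.finrank_ker_add_one_of_ne_zero hf
  rw [IsHyperplane] at hH
  exact ⟨f, hf, (Submodule.eq_of_le_of_finrank_le hle (by omega)).symm⟩

lemma ncard_pointsOn_ker (K : Set (ℙ F V)) [Fintype K] (f : Dual F V) :
    (pointsOn K (LinearMap.ker f)).ncard = (zeros (fun P : K => P.1.rep) f).card := by
  rw [← Set.ncard_coe_finset, ← Set.ncard_image_of_injective _ Subtype.val_injective]
  congr 1
  ext P
  simp [pointsOn, incident_ker, mem_zeros, and_comm]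

lemma exists_hyperplane_separating [FiniteDimensional F V] {X Y : ℙ F V} (h : X ≠ Y) :
    ∃ H : Submodule F V, IsHyperplane H ∧ Incident X H ∧ ¬ Incident Y H := by
  have h1 : Y.rep ∉ X.submodule := by
    intro h1
    refine h (Projectivization.submodule_injective ?_).symm
    refine Submodule.eq_of_le_of_finrank_le ?_ ?_
    · rwa [Projectivization.submodule_eq Y, Submodule.span_singleton_le_iff_mem]
    · rw [Projectivization.finrank_submodule, Projectivization.finrank_submodule]
  obtain ⟨f, hf, hle⟩ := Submodule.exists_le_ker_of_notMem h1
  refine ⟨LinearMap.ker f, isHyperplane_ker ?_, hle, fun h2 => hf (incident_ker.1 h2)⟩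
  rintro rfl
  exact hf rfl

lemma pointsOn_insert_of_incident {K : Set (ℙ F V)} {X : ℙ F V} {H : Submodule F V}
    (h : Incident X H) : pointsOn (insert X K) H = insert X (pointsOn K H) := by
  ext P
  simp only [pointsOn, Set.mem_insert_iff, Set.mem_ofPred_eq]
  constructor
  · tauto
  · rintro (rfl | h1)
    · exact ⟨Or.inl rfl, h⟩
    · tauto

lemma pointsOn_insert_of_not_incident {K : Set (ℙ F V)} {X : ℙ F V} {H : Submodule F V}
    (h : ¬ Incident X H) : pointsOn (insert X K) H = pointsOn K H := by
  ext P
  simp only [pointsOn, Set.mem_insert_iff, Set.mem_ofPred_eq]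
  constructor
  · rintro ⟨rfl | h1, h2⟩
    · exact (h h2).elim
    · exact ⟨h1, h2⟩
  · tauto

/-- In a plane, two distinct points `X` and `Y` and a set of points not contained in the line `XY`:
some line through `Y` and a point of the set does not pass through `X`. -/
lemma exists_line_avoiding [FiniteDimensional F V] (hV : 3 ≤ finrank F V) {K : Set (ℙ F V)}
    {X Y : ℙ F V} (hXY : X ≠ Y)
    (hK : ∀ H, IsHyperplane H → Incident X H → ∃ P ∈ K, ¬ Incident P H) :
    ∃ P ∈ K, ∃ H, IsHyperplane H ∧ Incident P H ∧ Incident Y H ∧ ¬ Incident X H := by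
  obtain ⟨H₁, -, hYH₁, hXH₁⟩ := exists_hyperplane_separating hXY.symm
  have hXY' : X.rep ∉ Submodule.span F {Y.rep} := fun h => hXH₁ (by
    rw [Incident, Projectivization.submodule_eq, Submodule.span_singleton_le_iff_mem]
    rw [Incident, Projectivization.submodule_eq] at hYH₁
    exact hYH₁ h)
  have hlt : Submodule.span F {Y.rep} ⊔ Submodule.span F {X.rep} < ⊤ := by
    refine lt_top_iff_ne_top.2 fun h => ?_
    have h1 := finrank_sup_span_singleton hXY'
    rw [h, finrank_top, finrank_span_singleton Y.rep_nonzero] at h1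
    omega
  obtain ⟨f, hf, hle⟩ := Submodule.exists_le_ker_of_lt_top _ hlt
  rw [sup_le_iff, Submodule.span_singleton_le_iff_mem, Submodule.span_singleton_le_iff_mem] at hle
  obtain ⟨P, hPK, hP⟩ := hK _ (isHyperplane_ker hf) (incident_ker.2 hle.2)
  rw [incident_ker] at hP
  -- `f` vanishes at X and Y but not at P, so X in this span would be a multiple of Y.
  have hX : X.rep ∉ Submodule.span F {P.rep, Y.rep} := by
    intro h
    obtain ⟨a, b, hab⟩ := Submodule.mem_span_pair.1 h
    have h1 := congrArg f hab
    rw [map_add, map_smul, map_smul, hle.1, hle.2, smul_zero, add_zero, smul_eq_mul] at h1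
    rw [(mul_eq_zero.1 h1).resolve_right hP, zero_smul, zero_add] at hab
    exact hXY' (Submodule.mem_span_singleton.2 ⟨b, hab⟩)
  obtain ⟨g, hg, hgle⟩ := Submodule.exists_le_ker_of_notMem hX
  refine ⟨P, hPK, LinearMap.ker g, isHyperplane_ker ?_, ?_, ?_, fun h => hg (incident_ker.1 h)⟩
  · rintro rfl
    exact hg rfl
  · exact incident_ker.2 (hgle (Submodule.subset_span (by simp)))
  · exact incident_ker.2 (hgle (Submodule.subset_span (by simp)))

variable [Finite F]

/-- A planar arc that is one point short of being maximal has a nucleus, if its degree divides the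
order of the plane: a point whose lines are the tangents of the arc. -/
lemma IsArc.exists_nucleus {K : Set (ℙ F V)} {n s : ℕ} (hK : IsArc K n (s + 2))
    (hV : finrank F V = 3) (hdvd : s + 2 ∣ Nat.card F) (hn : n = (s + 1) * (Nat.card F + 1)) :
    ∃ X : ℙ F V, X ∉ K ∧
      (∀ H, IsHyperplane H → Incident X H → (pointsOn K H).ncard = s + 1) ∧
      (∀ H, IsHyperplane H → ¬ Incident X H →
        (pointsOn K H).ncard = s + 2 ∨ (pointsOn K H).ncard = 0) := by
  have : FiniteDimensional F V := FiniteDimensional.of_finrank_pos (by omega)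
  have : Fintype F := Fintype.ofFinite F
  have : Finite V := Module.finite_of_finite F
  have : Finite (Dual F V) := Module.finite_of_finite F
  have : Fintype V := Fintype.ofFinite _
  have : Fintype (Dual F V) := Fintype.ofFinite _
  have : Fintype K := hK.finite.fintype
  rw [Nat.card_eq_fintype_card] at hdvd hn
  obtain ⟨x, hx, h1, h2, h3⟩ := PGArc.exists_nucleus (F := F) (v := fun P : K => P.1.rep)
    (ρ := s + 1) (by omega) hV
    (by rw [← Nat.card_eq_fintype_card, Nat.card_coe_set_eq, hK.card_eq, hn]) hdvd
    (fun f hf => by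
      rw [← ncard_pointsOn_ker]
      exact hK.le_of_hyperplane _ (isHyperplane_ker hf))
  refine ⟨Projectivization.mk F x hx, fun hX => h3 ⟨_, hX⟩ ?_, fun H hH hX => ?_, fun H hH hX => ?_⟩
  · rw [← Projectivization.submodule_eq, Projectivization.submodule_mk]
    exact Submodule.mem_span_singleton_self _
  · obtain ⟨f, hf, rfl⟩ := hH.exists_ker_eq
    rw [ncard_pointsOn_ker]
    exact h1 f hf ((incident_mk_ker hx).1 hX)
  · obtain ⟨f, hf, rfl⟩ := hH.exists_ker_eq
    rw [ncard_pointsOn_ker]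
    exact h2 f fun h => hX ((incident_mk_ker hx).2 h)

/-- Arcs one point short of being maximal, with `0 < s < q - 2` and `s + 2 ∣ q`, are planar. -/
lemma IsArc.finrank_eq_three {K : Set (ℙ F V)} {n s : ℕ}
    (hK : IsArc K n (finrank F V + s - 1)) (hV : 3 ≤ finrank F V) (hs : 0 < s)
    (hsq : s + 2 < Nat.card F) (hdvd : s + 2 ∣ Nat.card F)
    (hn : n = (s + 1) * (Nat.card F + 1) + finrank F V - 3) : finrank F V = 3 := by
  by_contra hne
  have : FiniteDimensional F V := FiniteDimensional.of_finrank_pos (by omega)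
  have : Fintype F := Fintype.ofFinite F
  have : Fintype K := hK.finite.fintype
  rw [Nat.card_eq_fintype_card] at hdvd hn hsq
  -- A proper divisor of q is at most q / 2.
  have hq : 2 * (s + 1 + 1) ≤ Fintype.card F := by
    obtain ⟨t, ht⟩ := hdvd
    rw [ht] at hsq ⊢
    have : 1 < t := by
      by_contra! h
      nlinarith
    nlinarith
  refine no_almost_maximal_family (ρ := s + 1) (by omega) hdvd hq (finrank F V - 4)
    (fun P : K => P.1.rep) (by omega) ?_ ?_
  · rw [← Nat.card_eq_fintype_card, Nat.card_coe_set_eq, hK.card_eq, hn]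
    omega
  · intro f hf
    rw [← ncard_pointsOn_ker]
    exact (hK.le_of_hyperplane _ (isHyperplane_ker hf)).trans (by omega)

end Translation
end PGArc

/-! ### The main theorem -/

theorem mainTheorem1 {F V : Type*} [Field F] [Finite F] [AddCommGroup V] [Module F V]
    (q k s n : ℕ) (hq : Nat.card F = q) (hV : Module.finrank F V = k)
    (hk : 3 ≤ k) (hs : 0 < s) (hsq : s + 2 < q) (hdvd : s + 2 ∣ q)
    (hn : n = (s + 1) * (q + 1) + k - 3)
    (K : Set (ℙ F V)) (hK : PGArc.IsArc K n (k + s - 1)) :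
    (∃! X : ℙ F V,
      (∀ H : Submodule F V, PGArc.IsTangent K (k + s - 1) H → PGArc.Incident X H) ∧
      (∀ H : Submodule F V, PGArc.IsSecant K (k + s - 1) H → ¬ PGArc.Incident X H)) ∧
    ¬ PGArc.IsComplete K n (k + s - 1) ∧
    (∃! K' : Set (ℙ F V), K ⊆ K' ∧ PGArc.IsMaximalArc K' (n + 1) s) := by
  subst hq hV
  have hV := hK.finrank_eq_three hk hs hsq hdvd hn
  have : FiniteDimensional F V := FiniteDimensional.of_finrank_pos (by omega)
  have hr : Module.finrank F V + s - 1 = s + 2 := by omega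
  have hKn := hK.lt_n
  rw [hr] at hK hKn ⊢
  obtain ⟨X, hXK, h1, h2⟩ := hK.exists_nucleus hV hdvd (by rw [hn]; omega)
  have hins : PGArc.IsArc (insert X K) (n + 1) (s + 2) := by
    refine ⟨hK.le_r, by omega, hK.finite.insert X, ?_, fun H hH => ?_, ?_⟩
    · rw [Set.ncard_insert_of_notMem hXK hK.finite, hK.card_eq]
    · by_cases hX : PGArc.Incident X H
      · rw [PGArc.pointsOn_insert_of_incident hX]
        exact (Set.ncard_insert_le _ _).trans (by rw [h1 H hH hX])
      · rw [PGArc.pointsOn_insert_of_not_incident hX]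
        exact hK.le_of_hyperplane H hH
    · obtain ⟨H, hH, hHr⟩ := hK.exists_hyperplane
      have hX : ¬ PGArc.Incident X H := fun hX => by
        rw [h1 H hH hX] at hHr
        omega
      exact ⟨H, hH, by rw [PGArc.pointsOn_insert_of_not_incident hX, hHr]⟩
  refine ⟨⟨X, ⟨fun H hH => ?_, fun H hH hX => ?_⟩, fun Y hY => ?_⟩, fun hc => hc.2 ⟨X, hXK, hins⟩,
    insert X K, ⟨Set.subset_insert _ _, by rwa [hr], by omega⟩, ?_⟩
  · by_contra hX
    rcases h2 H hH.1 hX with h | h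
    · exact absurd hH.2.2 (by omega)
    · exact absurd hH.2.1 (by omega)
  · have := hH.2
    rw [h1 H hH.1 hX] at this
    omega
  -- A line through X but not Y has s + 1 arc points, so it is a tangent missing Y.
  · by_contra hne
    obtain ⟨H, hH, hXH, hYH⟩ := PGArc.exists_hyperplane_separating (Ne.symm hne)
    have := h1 H hH hXH
    exact hYH (hY.1 H ⟨hH, by omega, by omega⟩)
  · rintro K' ⟨hsub, hK', -⟩
    rw [hr] at hK'
    obtain ⟨Y, hYK, rfl⟩ := (Set.exists_eq_insert_iff_ncard hK.finite).2
      ⟨hsub, by rw [hK.card_eq, hK'.card_eq]⟩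
    by_cases hXY : X = Y
    · rw [hXY]
    -- A line on Y and an arc point that misses X is already a secant, so Y cannot be added.
    obtain ⟨P, hPK, H, hH, hPH, hYH, hXH⟩ := PGArc.exists_line_avoiding hk hXY (K := K) (by
      intro H hH hXH
      by_contra! hcon
      have h3 : PGArc.pointsOn K H = K := Set.Subset.antisymm (fun P hP => hP.1)
        fun P hP => ⟨hP, hcon P hP⟩
      have h4 := h1 H hH hXH
      rw [h3, hK.card_eq] at h4
      omega)
    have hfin : (PGArc.pointsOn K H).Finite := hK.finite.subset fun P hP => hP.1
    have h3 : (PGArc.pointsOn K H).ncard = s + 2 := (h2 H hH hXH).resolve_right fun h0 => by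
      rw [Set.ncard_eq_zero hfin] at h0
      have : P ∈ PGArc.pointsOn K H := ⟨hPK, hPH⟩
      rw [h0] at this
      exact this
    have h4 := hK'.le_of_hyperplane H hH
    rw [PGArc.pointsOn_insert_of_incident hYH,
      Set.ncard_insert_of_notMem (fun h => hYK h.1) hfin, h3] at h4
    omega
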